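/- **Setting.** Let $n\le m$, $m\ge 2$, $1\le k$, and let $A\in\mathbb R^{n\times m}$ have unit-norm columns $A_1,\dots,A_m$ with $|\langle A_i,A_j\rangle|\le \mu/\sqrt n$ for $i\ne j$, where $\mu\ge 1$, and spectral norm at most $\sigma$. Let $\mathcal D^{(v)}$ be a symmetric probability distribution on $[-C,-1]\cup[1,C]$, $C\ge 1$. For a distribution $\mathcal D$ on $\{0,1\}^m$, let $\mathcal D\odot\mathcal D^{(v)}$ be the law of the vector $x\in\mathbb R^m$ obtained by drawing a support from $\mathcal D$ and then, independently, the nonzero coordinates from $\mathcal D^{(v)}$. Let $\mathcal D_R^{(s)}$ be a distribution over vectors in $\{0,1\}^m$ with at most $k$ ones, such that each coordinate is nonzero with probability exactly $k/m$ and, for every $i$ and every $T\not\ni i$ with $|T|\le\kappa\log m$, $P(\xi_i\neq0\mid \xi_j\ne 0\ \forall j\in T)\le \tau k/m$ whenever the conditioning event has positive probability; here $\tau\ge1$ and $\kappa>0$. Let $\widetilde{\mathcal D}^{(s)}$ be an arbitrary fixed distribution over vectors in $\{0,1\}^m$ with at most $k$ ones, with marginals $q_i=P_{\widetilde{\mathcal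 D}^{(s)}}(\xi_i\ne0)$, and assume that $q_1\ge \max_i q_i/\log m$. (The index $1$ may be any fixed index.) Write $q_1(2L)=\mathbb E_{x\sim\widetilde{\mathcal D}^{(s)}\odot\mathcal D^{(v)}}[x_1^{2L}]$ and $$\nu(\eta,d)=c_1\Big(C\big(\sigma^2+\mu\sqrt{m/n}\big)\log^2(n/\eta)\Big)^d .$$ **Theorem.** There is an absolute constant $c_1>0$ such that for all constants $c\ge2$, integers $L\ge8$, $C\ge1$ and $\kappa>0$ there is a constant $K=K(c,L,C,\kappa)$ for which the following holds for all data as above. Let $\zeta^{(1)},\dots,\zeta^{(2L-1)}$ be independent draws from $\mathcal D_R^{(s)}\odot\mathcal D^{(v)}$, each conditioned on $\zeta^{(t)}_1>0$, and let $u^{(t)}=A\zeta^{(t)}$. If $$k\le \frac{\sqrt n}{\nu(\tfrac1m,2L)\,\tau\,\mu^2\,(\log m)^{\max\{0,\,c-4L\}}}$$ (so $k\le\sqrt n/(\nu(\frac1m,2L)\tau\mu^2)$ when $c\le 4L$), then with probability at least $1-\frac1{\log^2m}$ over $\zeta^{(1)},\dots,\zeta^{(2L-1)}$, $$\mathbb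 E_{y=Ax,\ x\sim\widetilde{\mathcal D}^{(s)}\odot\mathcal D^{(v)}}\Big[\langle u^{(1)},y\rangle\cdots\langle u^{(2L-1)},y\rangle\,y\Big]=a_1A_1+e_1,\qquad \|e_1\|\le K\,\frac{q_1}{\log^c m},$$ where $a_1=q_1(2L)\prod_{t=1}^{2L-1}\zeta^{(t)}_1$, which satisfies $q_1\le a_1\le C^{4L-1}q_1$. In particular $a_1=q_1$ if $\mathcal D^{(v)}$ is the Rademacher distribution on $\{\pm1\}$. -/

import Mathlib

open MeasureTheory ProbabilityTheory
open scoped BigOperators Matrix ENNReal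

noncomputable section

namespace SparseCoding

/-- The `i`-th column of the dictionary, as a vector of Euclidean space. -/
def column {n m : ℕ} (A : Matrix (Fin n) (Fin m) ℝ) (i : Fin m) : EuclideanSpace ℝ (Fin n) :=
  WithLp.toLp 2 (A.col i)

/-- The sample `A x = ∑ i, x i • A_i` with coefficient vector `x`, as a vector of
Euclidean space. -/
def synth {n m : ℕ} (A : Matrix (Fin n) (Fin m) ℝ) (x : Fin m → ℝ) :
    EuclideanSpace ℝ (Fin n) :=
  WithLp.toLp 2 (A *ᵥ x)

/-- The spectral norm: the operator norm of `A : ℝᵐ → ℝⁿ` for the Euclidean norms. -/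
def dictNorm {n m : ℕ} (A : Matrix (Fin n) (Fin m) ℝ) : ℝ :=
  ‖LinearMap.toContinuousLinearMap (Matrix.toEuclideanLin A)‖

/-- `μ`-incoherence: the columns are unit vectors, and distinct columns have inner product at
most `μ / √n` in absolute value. -/
structure Incoherent {n m : ℕ} (A : Matrix (Fin n) (Fin m) ℝ) (μ : ℝ) : Prop where
  norm_column : ∀ i, ‖column A i‖ = 1
  abs_inner_le : ∀ i j, i ≠ j → |inner ℝ (column A i) (column A j)| ≤ μ / √(n : ℝ)

/-- Value distributions: symmetric probability measures on `[-C, -1] ∪ [1, C]`.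
(Such a measure automatically has mean zero.) -/
structure IsValueDistribution (V : Measure ℝ) (C : ℝ) : Prop where
  isProbabilityMeasure : IsProbabilityMeasure V
  symmetric : V.map (fun v => -v) = V
  supported : V (Set.Icc (-C) (-1) ∪ Set.Icc 1 C)ᶜ = 0

/-- A distribution over supports with at most `k` elements. A vector of `{0,1}ᵐ` is identified
with the set of the coordinates at which it is `1`. -/
def IsSparse {m : ℕ} (D : PMF (Finset (Fin m))) (k : ℕ) : Prop :=
  ∀ S ∈ D.support, S.card ≤ k

/-- The marginal `q_T` of a support distribution: the probability that the random support
contains all the indices in `T`. -/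
def marginal {m : ℕ} (D : PMF (Finset (Fin m))) (T : Finset (Fin m)) : ℝ :=
  ∑ S : Finset (Fin m) with T ⊆ S, (D S).toReal

/-- The random support distributions: at most `k` nonzeros, every coordinate is nonzero with
probability `k / m`, and conditioned on any set `T` of at most `κ log m` other coordinates being
nonzero, a coordinate is nonzero with probability at most `τ k / m` (the conditional probability
is multiplied out, so that nothing is demanded if the conditioning event has probability zero). -/
structure IsRandomSupport {m : ℕ} (R : PMF (Finset (Fin m))) (k : ℕ) (τ κ : ℝ) : Prop where
  sparse : IsSparse R k
  marginal_eq : ∀ i, marginal R {i} = (k : ℝ) / m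
  negCorrelated : ∀ (i : Fin m) (T : Finset (Fin m)), i ∉ T → (T.card : ℝ) ≤ κ * Real.log m →
    marginal R (insert i T) ≤ τ * ((k : ℝ) / m) * marginal R T

/-- The law `D ⊙ V` on `ℝᵐ`: draw a support `S` from `D`; given `S`, the coordinates in `S` are
drawn independently from `V`, and the other coordinates are zero. -/
def sparseLaw {m : ℕ} (D : PMF (Finset (Fin m))) (V : Measure ℝ) : Measure (Fin m → ℝ) :=
  ∑ S : Finset (Fin m),
    D S • Measure.pi (fun i => if i ∈ S then V else Measure.dirac (0 : ℝ))

/-- The law of `N` independent draws from `R ⊙ V`, each conditioned on its coordinate `i₁` being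
positive. -/
def tupleLaw {m : ℕ} (R : PMF (Finset (Fin m))) (V : Measure ℝ) (i₁ : Fin m) (N : ℕ) :
    Measure (Fin N → Fin m → ℝ) :=
  Measure.pi fun _ => ProbabilityTheory.cond (sparseLaw R V) {x | 0 < x i₁}

/-- The statistic `E[⟨u⁽¹⁾, y⟩ ⋯ ⟨u⁽ᴺ⁾, y⟩ y]` for `u⁽ᵗ⁾ = A ζ⁽ᵗ⁾`, where `y = A x` and
`x ∼ D ⊙ V`. -/
def statistic {n m N : ℕ} (A : Matrix (Fin n) (Fin m) ℝ) (D : PMF (Finset (Fin m)))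
    (V : Measure ℝ) (ζ : Fin N → Fin m → ℝ) : EuclideanSpace ℝ (Fin n) :=
  ∫ x, (∏ t, inner ℝ (synth A (ζ t)) (synth A x)) • synth A x ∂(sparseLaw D V)

/-- The moment `q_i(d) = E[x_i ^ d]` for `x ∼ D ⊙ V`. -/
def moment {m : ℕ} (D : PMF (Finset (Fin m))) (V : Measure ℝ) (i : Fin m) (d : ℕ) : ℝ :=
  ∫ x, x i ^ d ∂(sparseLaw D V)

/-- `ν(η, d) = c₁ (C (σ² + μ √(m/n)) log²(n/η))ᵈ`. -/
def nu (c₁ C σ μ : ℝ) (n m : ℕ) (η : ℝ) (d : ℕ) : ℝ :=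
  c₁ * (C * (σ ^ 2 + μ * √((m : ℝ) / n)) * Real.log (n / η) ^ 2) ^ d

end SparseCoding

end

noncomputable section

namespace SparseCoding

/-! Let G be the Gram matrix, e the unit vector of i₁ and Z = G - e eᵀ the noise operator. Then ⟨Aζ,
Ax⟩ = ζ_{i₁} x_{i₁} + ⟨ζ, Zx⟩, and multiplying out the factors writes the statistic as a sum over
the sets T of factors that contribute noise (`statistic_eq_sum`). The term T = ∅ is exactly the main
term, since sign symmetry kills every coordinate except i₁. All other terms must be O(q / log^c m),
q being the marginal of i₁, outside an event of probability 1 / log² m in the seeds. They are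
controlled by moments and Markov's inequality.

For |T| ≥ 2 the second moment over the seeds suffices. Squaring introduces an independent copy y of
x, and by independence each factor in T becomes the bilinear form ∑ v_l (Zx)_l (Zy)_l, where v_l is
the second moment of the seed coordinate l (`integral_sum_noiseMoment_sq`). For fixed y this is a
linear form in x, whose coefficients have small ℓ² norm on every set of at most k coordinates
(`Incoherent.sum_noise_sq_le`): v is of order τk/m off i₁, and row and column i₁ of Z are
incoherent. Khintchine's inequality given the support bounds the powers of this form, up to
constants, by powers of √γ, γ = k³τ²μ⁴σ⁸/n². The remaining factor (x_{i₁}y_{i₁})^(N-|T|) ⟨x, y⟩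
forces the supports to meet: at i₁ if T is not everything, which costs k q²; otherwise anywhere,
which costs m q² log² m but comes with at least four noise factors.

For |T| = 1 that bound is too weak. By sign symmetry the term is explicit, with coordinates θ_i
(Zζ)_i, where θ is small in every ℓʲ norm (`coupling_sums`). Its squared norm splits into a part
small for every seed, a part bounded by an ℓ¹ norm with small mean, and an off-diagonal quadratic
form with small second moment (`Incoherent.sum_mul_noise_sq_le`).

The sparsity condition enters only through `ParameterBounds`, which reduces each estimate to a
comparison of monomials with powers of √n. -/

/-! ### Sparse laws -/

/-- The law of the coefficient vector given its support. -/
def supportLaw {m : ℕ} (V : Measure ℝ) (S : Finset (Fin m)) : Measure (Fin m → ℝ) :=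
  Measure.pi fun i => if i ∈ S then V else Measure.dirac (0 : ℝ)

/-- Vectors with at most `k` nonzero entries, whose nonzero entries have absolute value in
`[1, C]`. -/
structure Admissible {m : ℕ} (k : ℕ) (C : ℝ) (x : Fin m → ℝ) : Prop where
  abs_le : ∀ i, |x i| ≤ C
  one_le : ∀ i, x i ≠ 0 → 1 ≤ |x i|
  card_le : (Finset.univ.filter fun i => x i ≠ 0).card ≤ k

/-- Changing the sign of one coordinate. -/
def flipAt {m : ℕ} (j : Fin m) (x : Fin m → ℝ) : Fin m → ℝ :=
  fun i => if i = j then -x i else x i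

lemma flipAt_self {m : ℕ} (j : Fin m) (x : Fin m → ℝ) : flipAt j x j = -x j := by
  simp [flipAt]

lemma flipAt_of_ne {m : ℕ} {i j : Fin m} (h : i ≠ j) (x : Fin m → ℝ) : flipAt j x i = x i := by
  simp [flipAt, h]

lemma measurable_flipAt {m : ℕ} (j : Fin m) : Measurable (flipAt j) := by
  refine measurable_pi_lambda _ fun i => ?_
  unfold flipAt
  split_ifs <;> fun_prop

lemma flipAt_flipAt {m : ℕ} (j : Fin m) (x : Fin m → ℝ) : flipAt j (flipAt j x) = x := by
  funext i
  by_cases h : i = j <;> simp [flipAt, h]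

instance isProbabilityMeasure_ite {m : ℕ} (V : Measure ℝ) [IsProbabilityMeasure V]
    (S : Finset (Fin m)) (i : Fin m) :
    IsProbabilityMeasure (if i ∈ S then V else Measure.dirac (0 : ℝ)) := by
  split_ifs <;> infer_instance

instance isProbabilityMeasure_supportLaw {m : ℕ} (V : Measure ℝ) [IsProbabilityMeasure V]
    (S : Finset (Fin m)) : IsProbabilityMeasure (supportLaw V S) := by
  unfold supportLaw; infer_instance

lemma sparseLaw_apply {m : ℕ} (D : PMF (Finset (Fin m))) (V : Measure ℝ)
    (s : Set (Fin m → ℝ)) : sparseLaw D V s = ∑ S, D S * supportLaw V S s := by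
  simp [sparseLaw, supportLaw, Measure.finsetSum_apply]

instance isProbabilityMeasure_sparseLaw {m : ℕ} (D : PMF (Finset (Fin m))) (V : Measure ℝ)
    [IsProbabilityMeasure V] : IsProbabilityMeasure (sparseLaw D V) := by
  constructor
  rw [sparseLaw_apply]
  simp only [measure_univ, mul_one]
  rw [← tsum_fintype (L := .unconditional _), D.tsum_coe]

lemma ae_sparseLaw {m : ℕ} {D : PMF (Finset (Fin m))} {V : Measure ℝ}
    {p : (Fin m → ℝ) → Prop} (h : ∀ S ∈ D.support, ∀ᵐ x ∂supportLaw V S, p x) :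
    ∀ᵐ x ∂sparseLaw D V, p x := by
  rw [ae_iff, sparseLaw_apply, Finset.sum_eq_zero_iff]
  intro S _
  by_cases hS : S ∈ D.support
  · rw [mul_eq_zero]; exact Or.inr (h S hS)
  · rw [PMF.mem_support_iff, not_not] at hS
    simp [hS]

lemma ae_supportLaw {m : ℕ} {V : Measure ℝ} {C : ℝ} (hV : IsValueDistribution V C)
    (S : Finset (Fin m)) :
    ∀ᵐ x ∂supportLaw V S, ∀ i, (i ∈ S → 1 ≤ |x i| ∧ |x i| ≤ C) ∧ (i ∉ S → x i = 0) := by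
  have := hV.isProbabilityMeasure
  rw [ae_all_iff]
  intro i
  have key : ∀ᵐ v ∂(if i ∈ S then V else Measure.dirac (0 : ℝ)),
      (i ∈ S → 1 ≤ |v| ∧ |v| ≤ C) ∧ (i ∉ S → v = 0) := by
    by_cases hi : i ∈ S
    · simp only [hi, if_true, true_imp_iff, not_true, false_imp_iff, and_true]
      refine measure_mono_null ?_ hV.supported
      intro v hv hv'
      apply hv
      rcases hv' with ⟨h1, h2⟩ | ⟨h1, h2⟩
      · change 1 ≤ |v| ∧ |v| ≤ C
        rw [abs_of_neg (by linarith)]; constructor <;> linarith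
      · change 1 ≤ |v| ∧ |v| ≤ C
        rw [abs_of_pos (by linarith)]; constructor <;> linarith
    · simp only [hi, if_false, not_false_iff, true_imp_iff, false_imp_iff, true_and]
      exact (ae_dirac_iff (measurableSet_singleton (0 : ℝ))).2 rfl
  exact (Measure.tendsto_eval_ae_ae
    (μ := fun i => if i ∈ S then V else Measure.dirac (0 : ℝ)) (i := i)).eventually key

lemma ae_admissible {m k : ℕ} {D : PMF (Finset (Fin m))} {V : Measure ℝ} {C : ℝ}
    (hV : IsValueDistribution V C) (hC : 0 ≤ C) (hD : IsSparse D k) :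
    ∀ᵐ x ∂sparseLaw D V, Admissible k C x := by
  refine ae_sparseLaw fun S hS => ?_
  filter_upwards [ae_supportLaw hV S] with x hx
  refine ⟨fun i => ?_, fun i hi => ?_, ?_⟩
  · by_cases hi : i ∈ S
    · exact ((hx i).1 hi).2
    · rw [(hx i).2 hi]; simpa using hC
  · by_cases hiS : i ∈ S
    · exact ((hx i).1 hiS).1
    · exact absurd ((hx i).2 hiS) hi
  · refine (Finset.card_le_card ?_).trans (hD S hS)
    intro i hi
    by_contra hiS
    exact (Finset.mem_filter.1 hi).2 ((hx i).2 hiS)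

lemma measurePreserving_flipAt_supportLaw {m : ℕ} {V : Measure ℝ} {C : ℝ}
    (hV : IsValueDistribution V C) (j : Fin m) (S : Finset (Fin m)) :
    MeasurePreserving (flipAt j) (supportLaw V S) (supportLaw V S) := by
  have := hV.isProbabilityMeasure
  have h := measurePreserving_pi (μ := fun i => if i ∈ S then V else Measure.dirac (0 : ℝ))
    (ν := fun i => if i ∈ S then V else Measure.dirac (0 : ℝ))
    (f := fun i v => if i = j then -v else v) (fun i => by
      by_cases hij : i = j
      · simp only [hij, if_true]
        refine ⟨measurable_neg, ?_⟩
        split_ifs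
        · exact hV.symmetric
        · simp [Measure.map_dirac' (measurable_neg (G := ℝ)) 0]
      · simp only [hij, if_false]
        exact MeasurePreserving.id _)
  exact h

lemma measurePreserving_flipAt_sparseLaw {m : ℕ} {V : Measure ℝ} {C : ℝ}
    (hV : IsValueDistribution V C) (D : PMF (Finset (Fin m))) (j : Fin m) :
    MeasurePreserving (flipAt j) (sparseLaw D V) (sparseLaw D V) := by
  refine ⟨measurable_flipAt j, Measure.ext fun s hs => ?_⟩
  rw [Measure.map_apply (measurable_flipAt j) hs, sparseLaw_apply, sparseLaw_apply]
  refine Finset.sum_congr rfl fun S _ => ?_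
  rw [(measurePreserving_flipAt_supportLaw hV j S).measure_preimage hs.nullMeasurableSet]

/-- Source of all the cancellations. The flip is a measurable bijection, so no integrability of f is
needed. -/
lemma integral_eq_zero_of_flipAt {m : ℕ} {μ : Measure (Fin m → ℝ)} {j : Fin m}
    (hμ : MeasurePreserving (flipAt j) μ μ) {f : (Fin m → ℝ) → ℝ}
    (hf : ∀ x, f (flipAt j x) = -f x) : ∫ x, f x ∂μ = 0 := by
  have he : MeasurableEmbedding (flipAt j) :=
    (MeasurableEquiv.mk ⟨flipAt j, flipAt j, flipAt_flipAt j, flipAt_flipAt j⟩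
      (measurable_flipAt j) (measurable_flipAt j)).measurableEmbedding
  have h := hμ.integral_comp he f
  simp only [hf, integral_neg] at h
  linarith

/-- A continuous function is integrable for a finite measure carried by a compact set. -/
lemma integrable_of_continuous {E : Type*} [TopologicalSpace E] [MeasurableSpace E]
    [OpensMeasurableSpace E] {μ : Measure E} [IsFiniteMeasure μ] {s : Set E} (hs : IsCompact s)
    (hμ : ∀ᵐ x ∂μ, x ∈ s) {f : E → ℝ} (hf : Continuous f) : Integrable f μ := by
  obtain ⟨b, hb⟩ := hs.exists_bound_of_continuousOn hf.continuousOn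
  exact Integrable.of_bound hf.measurable.aestronglyMeasurable b (hμ.mono fun x hx => hb x hx)

/-- The box `[-C, C]ᵐ`. -/
def box (m : ℕ) (C : ℝ) : Set (Fin m → ℝ) := Set.univ.pi fun _ => Set.Icc (-C) C

lemma isCompact_box (m : ℕ) (C : ℝ) : IsCompact (box m C) :=
  isCompact_univ_pi fun _ => isCompact_Icc

lemma mem_box {m : ℕ} {C : ℝ} {x : Fin m → ℝ} : x ∈ box m C ↔ ∀ i, |x i| ≤ C := by
  simp only [box, abs_le, Set.mem_univ_pi, Set.mem_Icc]

lemma Admissible.mem_box {m k : ℕ} {C : ℝ} {x : Fin m → ℝ} (h : Admissible k C x) :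
    x ∈ box m C := SparseCoding.mem_box.2 h.abs_le

lemma integral_sparseLaw {m : ℕ} (D : PMF (Finset (Fin m))) (V : Measure ℝ)
    {f : (Fin m → ℝ) → ℝ} (hf : ∀ S, Integrable f (supportLaw V S)) :
    ∫ x, f x ∂sparseLaw D V = ∑ S, (D S).toReal * ∫ x, f x ∂supportLaw V S := by
  unfold sparseLaw
  rw [integral_finsetSum_measure]
  · refine Finset.sum_congr rfl fun S _ => ?_
    rw [integral_smul_measure]; rfl
  · intro S _
    exact (hf S).smul_measure (PMF.apply_ne_top D S)

lemma marginal_nonneg {m : ℕ} (D : PMF (Finset (Fin m))) (T : Finset (Fin m)) :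
    0 ≤ marginal D T := Finset.sum_nonneg fun _ _ => ENNReal.toReal_nonneg

lemma measureReal_forall_ne_zero {m : ℕ} {V : Measure ℝ} {C : ℝ}
    (hV : IsValueDistribution V C) (D : PMF (Finset (Fin m))) (T : Finset (Fin m)) :
    (sparseLaw D V).real {x | ∀ i ∈ T, x i ≠ 0} = marginal D T := by
  have := hV.isProbabilityMeasure
  rw [measureReal_def, sparseLaw_apply, ENNReal.toReal_sum
    fun S _ => ENNReal.mul_ne_top (PMF.apply_ne_top D S) (measure_ne_top _ _), marginal,
    Finset.sum_filter]
  refine Finset.sum_congr rfl fun S _ => ?_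
  split_ifs with h
  · have : ∀ᵐ x ∂supportLaw V S, x ∈ {x : Fin m → ℝ | ∀ i ∈ T, x i ≠ 0} := by
      filter_upwards [ae_supportLaw hV S] with x hx i hi h0
      have := ((hx i).1 (h hi)).1
      rw [h0, abs_zero] at this
      linarith
    have h1 : supportLaw V S {x : Fin m → ℝ | ∀ i ∈ T, x i ≠ 0} = 1 :=
      (measure_congr (Filter.eventuallyEq_univ.2 this)).trans measure_univ
    rw [h1, mul_one]
  · obtain ⟨i, hiT, hiS⟩ := Finset.not_subset.1 h
    have : ∀ᵐ x ∂supportLaw V S, ¬ x ∈ {x : Fin m → ℝ | ∀ i ∈ T, x i ≠ 0} := by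
      filter_upwards [ae_supportLaw hV S] with x hx hx'
      exact hx' i hiT ((hx i).2 hiS)
    have h0 : supportLaw V S {x : Fin m → ℝ | ∀ i ∈ T, x i ≠ 0} = 0 := by
      simpa [ae_iff] using this
    simp [h0]

/-- Symmetry replaces exp by cosh, and cosh t ≤ exp (t² / 2): the values are subgaussian with
variance proxy C². -/
lemma integral_exp_le {V : Measure ℝ} {C : ℝ} (hV : IsValueDistribution V C) (a : ℝ) :
    ∫ v, Real.exp (a * v) ∂V ≤ Real.exp (a ^ 2 * C ^ 2 / 2) := by
  have := hV.isProbabilityMeasure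
  have hb : ∀ᵐ v ∂V, v ∈ Set.Icc (-C) C := by
    refine measure_mono_null ?_ hV.supported
    intro v hv hv'
    apply hv
    rcases hv' with ⟨h1, h2⟩ | ⟨h1, h2⟩ <;> constructor <;> linarith
  have hi : ∀ a : ℝ, Integrable (fun v => Real.exp (a * v)) V := fun a =>
    integrable_of_continuous isCompact_Icc hb (by fun_prop)
  have hsym : ∫ v, Real.exp (a * v) ∂V = ∫ v, Real.exp (-a * v) ∂V := by
    have : ∫ v, Real.exp (a * v) ∂(V.map fun v => -v) = ∫ v, Real.exp (a * -v) ∂V :=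
      integral_map measurable_neg.aemeasurable (by fun_prop)
    rw [hV.symmetric] at this
    rw [this]
    simp
  have hcosh : ∫ v, Real.exp (a * v) ∂V = ∫ v, Real.cosh (a * v) ∂V := by
    have : ∫ v, Real.cosh (a * v) ∂V
        = (∫ v, Real.exp (a * v) ∂V + ∫ v, Real.exp (-a * v) ∂V) / 2 := by
      rw [← integral_add (hi _) (hi _), ← integral_div]
      refine integral_congr_ae (Filter.Eventually.of_forall fun v => ?_)
      simp [Real.cosh_eq]
    rw [this, ← hsym]; ring
  rw [hcosh]
  calc ∫ v, Real.cosh (a * v) ∂V ≤ ∫ _, Real.exp (a ^ 2 * C ^ 2 / 2) ∂V := by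
        refine integral_mono_ae (integrable_of_continuous isCompact_Icc hb (by fun_prop))
          (integrable_const _) ?_
        filter_upwards [hb] with v hv
        refine (Real.cosh_le_exp_half_sq _).trans (Real.exp_le_exp.2 ?_)
        have : v ^ 2 ≤ C ^ 2 := sq_le_sq' hv.1 hv.2
        nlinarith [sq_nonneg a]
    _ = _ := by simp

/-- Khintchine's inequality for sparse vectors, from the subgaussian bound. -/
lemma integral_abs_dot_pow_supportLaw_le {m : ℕ} {V : Measure ℝ} {C : ℝ}
    (hV : IsValueDistribution V C) (hC : 0 < C) (S : Finset (Fin m)) (g : Fin m → ℝ) {b : ℝ}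
    (hb : 0 < b) (hg : ∑ i ∈ S, g i ^ 2 ≤ b ^ 2) (d : ℕ) :
    ∫ x, |∑ i, x i * g i| ^ d ∂supportLaw V S
      ≤ d.factorial * (2 * Real.exp (1 / 2)) * (C * b) ^ d := by
  have := hV.isProbabilityMeasure
  have hbox : ∀ᵐ x ∂supportLaw V S, x ∈ box m C := by
    filter_upwards [ae_supportLaw hV S] with x hx
    refine mem_box.2 fun i => ?_
    by_cases hi : i ∈ S
    · exact ((hx i).1 hi).2
    · rw [(hx i).2 hi]; simpa using hC.le
  have hexp : ∀ s : ℝ, ∫ x, Real.exp (s * ∑ i, x i * g i) ∂supportLaw V S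
      ≤ Real.exp (s ^ 2 * C ^ 2 * b ^ 2 / 2) := by
    intro s
    have h1 : ∀ x : Fin m → ℝ, Real.exp (s * ∑ i, x i * g i)
        = ∏ i, Real.exp ((s * g i) * x i) := by
      intro x
      rw [← Real.exp_sum, Finset.mul_sum]
      congr 1
      exact Finset.sum_congr rfl fun i _ => by ring
    simp_rw [h1]
    unfold supportLaw
    rw [integral_fintype_prod_eq_prod (fun i v => Real.exp ((s * g i) * v))]
    calc ∏ i, ∫ v, Real.exp ((s * g i) * v) ∂(if i ∈ S then V else Measure.dirac (0 : ℝ))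
        ≤ ∏ i, (if i ∈ S then Real.exp ((s * g i) ^ 2 * C ^ 2 / 2) else 1) := by
          refine Finset.prod_le_prod (fun i _ => integral_nonneg fun v => (Real.exp_pos _).le)
            fun i _ => ?_
          split_ifs
          · exact integral_exp_le hV _
          · simp
      _ = Real.exp (∑ i ∈ S, (s * g i) ^ 2 * C ^ 2 / 2) := by
          rw [Finset.prod_ite_mem, Finset.univ_inter, Real.exp_sum]
      _ ≤ _ := by
          refine Real.exp_le_exp.2 ?_
          have : ∑ i ∈ S, (s * g i) ^ 2 * C ^ 2 / 2 = s ^ 2 * C ^ 2 / 2 * ∑ i ∈ S, g i ^ 2 := by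
            rw [Finset.mul_sum]
            exact Finset.sum_congr rfl fun i _ => by ring
          rw [this]
          calc _ ≤ s ^ 2 * C ^ 2 / 2 * b ^ 2 := by gcongr
            _ = _ := by ring
  have hCb : 0 < C * b := mul_pos hC hb
  -- With this s the subgaussian exponent is 1/2. The factor 2 in the bound comes from exp (s|y|) ≤
  -- exp (sy) + exp (-sy), and d! from bounding a power by the exponential.
  set s : ℝ := (C * b)⁻¹ with hs
  have hs1 : ∀ r : ℝ, r ^ 2 = s ^ 2 → r ^ 2 * C ^ 2 * b ^ 2 / 2 = 1 / 2 := by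
    intro r hr
    rw [hr, hs]; field_simp
  have hpt : ∀ y : ℝ, |y| ^ d ≤ (d.factorial * (C * b) ^ d) *
      (Real.exp (s * y) + Real.exp (-s * y)) := by
    intro y
    have h1 := Real.pow_div_factorial_le_exp (x := s * |y|) (by positivity) d
    have h2 : Real.exp (s * |y|) ≤ Real.exp (s * y) + Real.exp (-s * y) := by
      rcases abs_cases y with ⟨h, _⟩ | ⟨h, _⟩
      · rw [h]; linarith [Real.exp_pos (-s * y)]
      · rw [h]
        have : s * -y = -s * y := by ring
        rw [this]; linarith [Real.exp_pos (s * y)]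
    have h3 : |y| ^ d = (d.factorial * (C * b) ^ d) * ((s * |y|) ^ d / d.factorial) := by
      have : ((d.factorial : ℕ) : ℝ) ≠ 0 := by exact_mod_cast d.factorial_ne_zero
      rw [hs, mul_pow (C * b)⁻¹, inv_pow]; field_simp
    rw [h3]
    exact mul_le_mul_of_nonneg_left (h1.trans h2) (by positivity)
  have hint : ∀ r : ℝ, Integrable (fun x : Fin m → ℝ => Real.exp (r * ∑ i, x i * g i))
      (supportLaw V S) := fun r =>
    integrable_of_continuous (isCompact_box m C) hbox (by fun_prop)
  calc ∫ x, |∑ i, x i * g i| ^ d ∂supportLaw V S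
      ≤ ∫ x, (d.factorial * (C * b) ^ d) * (Real.exp (s * ∑ i, x i * g i)
          + Real.exp (-s * ∑ i, x i * g i)) ∂supportLaw V S := by
        refine integral_mono (integrable_of_continuous (isCompact_box m C) hbox (by fun_prop))
          (((hint _).add (hint _)).const_mul _) fun x => hpt _
    _ = (d.factorial * (C * b) ^ d) * (∫ x, Real.exp (s * ∑ i, x i * g i) ∂supportLaw V S
          + ∫ x, Real.exp (-s * ∑ i, x i * g i) ∂supportLaw V S) := by
        rw [integral_const_mul, integral_add (hint _) (hint _)]
    _ ≤ (d.factorial * (C * b) ^ d) * (Real.exp (1 / 2) + Real.exp (1 / 2)) := by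
        gcongr
        · exact (hexp s).trans_eq (by rw [hs1 s rfl])
        · exact (hexp (-s)).trans_eq (by rw [hs1 (-s) (by ring)])
    _ = _ := by ring

/-! ### The Gram matrix of the dictionary -/

/-- The Gram matrix of the columns. -/
def gram {n m : ℕ} (A : Matrix (Fin n) (Fin m) ℝ) (i j : Fin m) : ℝ :=
  inner ℝ (column A i) (column A j)

lemma gram_comm {n m : ℕ} (A : Matrix (Fin n) (Fin m) ℝ) (i j : Fin m) :
    gram A i j = gram A j i := real_inner_comm _ _

lemma synth_eq_sum {n m : ℕ} (A : Matrix (Fin n) (Fin m) ℝ) (x : Fin m → ℝ) :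
    synth A x = ∑ i, x i • column A i := by
  ext r
  simp [synth, column, Matrix.mulVec, dotProduct, mul_comm]

lemma inner_column_synth {n m : ℕ} (A : Matrix (Fin n) (Fin m) ℝ) (x : Fin m → ℝ) (l : Fin m) :
    inner ℝ (column A l) (synth A x) = ∑ j, gram A l j * x j := by
  rw [synth_eq_sum, inner_sum]
  refine Finset.sum_congr rfl fun j _ => ?_
  rw [real_inner_smul_right, gram, mul_comm]

lemma inner_synth_synth {n m : ℕ} (A : Matrix (Fin n) (Fin m) ℝ) (z x : Fin m → ℝ) :
    inner ℝ (synth A z) (synth A x) = ∑ l, z l * ∑ j, gram A l j * x j := by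
  rw [synth_eq_sum A z, sum_inner]
  refine Finset.sum_congr rfl fun j _ => ?_
  rw [real_inner_smul_left, inner_column_synth]

lemma norm_synth_sq_le {n m : ℕ} {A : Matrix (Fin n) (Fin m) ℝ} {σ : ℝ} (hσ : dictNorm A ≤ σ)
    (x : Fin m → ℝ) : ‖synth A x‖ ^ 2 ≤ σ ^ 2 * ∑ i, x i ^ 2 := by
  have h := (LinearMap.toContinuousLinearMap (Matrix.toEuclideanLin A)).le_opNorm
    (WithLp.toLp 2 x)
  have h1 : (LinearMap.toContinuousLinearMap (Matrix.toEuclideanLin A)) (WithLp.toLp 2 x)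
      = synth A x := by
    simp [synth]
  rw [h1] at h
  have h2 : ‖(WithLp.toLp 2 x : EuclideanSpace ℝ (Fin m))‖ ^ 2 = ∑ i, x i ^ 2 := by
    rw [EuclideanSpace.norm_sq_eq]; simp
  have h3 : ‖synth A x‖ ≤ σ * ‖(WithLp.toLp 2 x : EuclideanSpace ℝ (Fin m))‖ :=
    h.trans (mul_le_mul_of_nonneg_right hσ (norm_nonneg _))
  calc ‖synth A x‖ ^ 2 ≤ (σ * ‖(WithLp.toLp 2 x : EuclideanSpace ℝ (Fin m))‖) ^ 2 := by gcongr
    _ = _ := by rw [mul_pow, h2]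

/-- The transpose of A has the same norm as A: testing A on w = Aᵀy gives ‖w‖² = ⟨Aw, y⟩ ≤ σ ‖w‖
‖y‖. -/
lemma sum_inner_column_sq_le {n m : ℕ} {A : Matrix (Fin n) (Fin m) ℝ} {σ : ℝ}
    (hσ : dictNorm A ≤ σ) (y : EuclideanSpace ℝ (Fin n)) :
    ∑ i, (inner ℝ (column A i) y) ^ 2 ≤ σ ^ 2 * ‖y‖ ^ 2 := by
  set w : Fin m → ℝ := fun i => inner ℝ (column A i) y with hw
  set s := ∑ i, w i ^ 2 with hs
  have hs0 : 0 ≤ s := Finset.sum_nonneg fun i _ => sq_nonneg _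
  have h1 : inner ℝ (synth A w) y = s := by
    rw [synth_eq_sum, sum_inner, hs]
    refine Finset.sum_congr rfl fun i _ => ?_
    rw [real_inner_smul_left, hw, sq]
  have h2 : s ≤ ‖synth A w‖ * ‖y‖ := h1 ▸ real_inner_le_norm _ _
  have h3 := norm_synth_sq_le hσ w
  have h4 : s * s ≤ s * (σ ^ 2 * ‖y‖ ^ 2) := by
    calc s * s ≤ (‖synth A w‖ * ‖y‖) * (‖synth A w‖ * ‖y‖) := by gcongr
      _ = ‖synth A w‖ ^ 2 * ‖y‖ ^ 2 := by ring
      _ ≤ (σ ^ 2 * s) * ‖y‖ ^ 2 := by gcongr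
      _ = _ := by ring
  rcases hs0.eq_or_lt with h | h
  · rw [← h]; positivity
  · exact le_of_mul_le_mul_left h4 h

lemma sum_gram_mulVec_sq_le {n m : ℕ} {A : Matrix (Fin n) (Fin m) ℝ} {σ : ℝ}
    (hσ : dictNorm A ≤ σ) (x : Fin m → ℝ) :
    ∑ l, (∑ j, gram A l j * x j) ^ 2 ≤ σ ^ 4 * ∑ i, x i ^ 2 := by
  calc ∑ l, (∑ j, gram A l j * x j) ^ 2 = ∑ l, (inner ℝ (column A l) (synth A x)) ^ 2 :=
        Finset.sum_congr rfl fun l _ => by rw [inner_column_synth]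
    _ ≤ σ ^ 2 * ‖synth A x‖ ^ 2 := sum_inner_column_sq_le hσ _
    _ ≤ σ ^ 2 * (σ ^ 2 * ∑ i, x i ^ 2) := by gcongr; exact norm_synth_sq_le hσ x
    _ = _ := by ring

lemma Incoherent.gram_self {n m : ℕ} {A : Matrix (Fin n) (Fin m) ℝ} {μ : ℝ}
    (hA : Incoherent A μ) (i : Fin m) : gram A i i = 1 := by
  rw [gram, real_inner_self_eq_norm_sq, hA.norm_column, one_pow]

lemma sum_gram_row_sq_le {n m : ℕ} {A : Matrix (Fin n) (Fin m) ℝ} {σ : ℝ}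
    (hσ : dictNorm A ≤ σ) (i : Fin m) : ∑ l, gram A l i ^ 2 ≤ σ ^ 4 := by
  have := sum_gram_mulVec_sq_le hσ (Pi.single i 1)
  simpa [Pi.single_apply, ite_pow] using this

lemma Incoherent.one_le_sigma {n m : ℕ} {A : Matrix (Fin n) (Fin m) ℝ} {μ σ : ℝ}
    (hA : Incoherent A μ) (hσ : dictNorm A ≤ σ) (i : Fin m) : 1 ≤ σ := by
  have h := norm_synth_sq_le hσ (Pi.single i 1)
  have h1 : synth A (Pi.single i 1) = column A i := by
    rw [synth_eq_sum]; simp [Pi.single_apply]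
  have h0 : 0 ≤ σ := (norm_nonneg _).trans hσ
  rw [h1, hA.norm_column] at h
  simp [Pi.single_apply, ite_pow] at h
  exact (abs_of_nonneg h0) ▸ h

/-- The operator `G - e eᵀ`, with `G` the Gram matrix and `e` the unit vector of `i₁`. -/
def noise {n m : ℕ} (A : Matrix (Fin n) (Fin m) ℝ) (i₁ : Fin m) (x : Fin m → ℝ) (l : Fin m) : ℝ :=
  (∑ j, gram A l j * x j) - if l = i₁ then x i₁ else 0

lemma sum_mul_noise_comm {n m : ℕ} (A : Matrix (Fin n) (Fin m) ℝ) (i₁ : Fin m)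
    (z x : Fin m → ℝ) : ∑ l, z l * noise A i₁ x l = ∑ l, noise A i₁ z l * x l := by
  simp only [noise, mul_sub, sub_mul, Finset.sum_sub_distrib]
  congr 1
  · simp only [Finset.mul_sum, Finset.sum_mul]
    rw [Finset.sum_comm]
    refine Finset.sum_congr rfl fun i _ => Finset.sum_congr rfl fun j _ => ?_
    rw [gram_comm]; ring
  · simp

lemma inner_synth_synth_eq {n m : ℕ} (A : Matrix (Fin n) (Fin m) ℝ) (i₁ : Fin m)
    (z x : Fin m → ℝ) :
    inner ℝ (synth A z) (synth A x) = z i₁ * x i₁ + ∑ l, z l * noise A i₁ x l := by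
  rw [inner_synth_synth]
  simp [noise, mul_sub, Finset.sum_sub_distrib]

/-- The part of the noise operator that comes from coordinate `i₁`. -/
def noiseCol {n m : ℕ} (A : Matrix (Fin n) (Fin m) ℝ) (i₁ : Fin m) (l : Fin m) : ℝ :=
  if l = i₁ then 0 else gram A l i₁

lemma Incoherent.noiseCol_sq_le {n m : ℕ} {A : Matrix (Fin n) (Fin m) ℝ} {μ : ℝ}
    (hA : Incoherent A μ) (i₁ l : Fin m) : noiseCol A i₁ l ^ 2 ≤ μ ^ 2 / n := by
  unfold noiseCol
  split_ifs with h
  · simp; positivity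
  · have := hA.abs_inner_le l i₁ h
    calc gram A l i₁ ^ 2 = |gram A l i₁| ^ 2 := (sq_abs _).symm
      _ ≤ (μ / √(n : ℝ)) ^ 2 := by gcongr; exact this
      _ = μ ^ 2 / n := by rw [div_pow, Real.sq_sqrt (Nat.cast_nonneg n)]

lemma Incoherent.noise_eq {n m : ℕ} {A : Matrix (Fin n) (Fin m) ℝ} {μ : ℝ}
    (hA : Incoherent A μ) (i₁ : Fin m) (x : Fin m → ℝ) (l : Fin m) :
    noise A i₁ x l = x i₁ * noiseCol A i₁ l
      + ∑ j, gram A l j * (if j = i₁ then 0 else x j) := by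
  have h : ∑ j, gram A l j * x j = gram A l i₁ * x i₁
      + ∑ j, gram A l j * (if j = i₁ then 0 else x j) := by
    have : gram A l i₁ * x i₁ = ∑ j, if j = i₁ then gram A l j * x j else 0 := by simp
    rw [this, ← Finset.sum_add_distrib]
    refine Finset.sum_congr rfl fun j _ => ?_
    split_ifs <;> simp
  rw [noise, h, noiseCol]
  split_ifs with hl
  · subst hl; rw [hA.gram_self]; ring
  · ring

lemma noise_of_ne {n m : ℕ} (A : Matrix (Fin n) (Fin m) ℝ) {i₁ l : Fin m} (h : l ≠ i₁)
    (x : Fin m → ℝ) : noise A i₁ x l = ∑ j, gram A l j * x j := by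
  simp [noise, h]

/-- By self-adjointness row i₁ of the noise operator is its column i₁, whose diagonal entry vanishes
because ‖A_{i₁}‖ = 1. Only inner products of size at most μ/√n remain. -/
lemma Incoherent.noise_self {n m : ℕ} {A : Matrix (Fin n) (Fin m) ℝ} {μ : ℝ}
    (hA : Incoherent A μ) (i₁ : Fin m) (x : Fin m → ℝ) :
    noise A i₁ x i₁ = ∑ j, noiseCol A i₁ j * x j := by
  have : noise A i₁ x i₁ = ∑ l, (Pi.single i₁ 1 : Fin m → ℝ) l * noise A i₁ x l := by
    simp [Pi.single_apply]
  rw [this, sum_mul_noise_comm]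
  refine Finset.sum_congr rfl fun l _ => ?_
  rw [hA.noise_eq]
  congr 1
  have : ∀ j, gram A l j * (if j = i₁ then 0 else (Pi.single i₁ 1 : Fin m → ℝ) j) = 0 := by
    intro j; by_cases h : j = i₁ <;> simp [h]
  simp [this]

lemma Admissible.sum_sq_le {m k : ℕ} {C : ℝ} {x : Fin m → ℝ} (hx : Admissible k C x) :
    ∑ i, x i ^ 2 ≤ k * C ^ 2 := by
  calc ∑ i, x i ^ 2 = ∑ i with x i ≠ 0, x i ^ 2 := by
        rw [Finset.sum_filter]
        refine Finset.sum_congr rfl fun i _ => ?_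
        split_ifs with h
        · rfl
        · rw [not_not] at h; simp [h]
    _ ≤ ∑ i with x i ≠ 0, C ^ 2 := Finset.sum_le_sum fun i _ => by
        rw [← sq_abs]; gcongr; exact hx.abs_le i
    _ ≤ k * C ^ 2 := by
        rw [Finset.sum_const, nsmul_eq_mul]
        gcongr; exact_mod_cast hx.card_le

lemma Admissible.sq_sum_mul_le {m k : ℕ} {C : ℝ} {x : Fin m → ℝ} (hx : Admissible k C x)
    {b : Fin m → ℝ} {r : ℝ} (hr : 0 ≤ r) (hb : ∀ i, b i ^ 2 ≤ r) :
    (∑ i, b i * x i) ^ 2 ≤ k * r * (k * C ^ 2) := by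
  have h : ∑ i, b i * x i = ∑ i with x i ≠ 0, b i * x i := by
    rw [Finset.sum_filter]
    refine Finset.sum_congr rfl fun i _ => ?_
    split_ifs with h
    · rfl
    · rw [not_not] at h; simp [h]
  rw [h]
  calc (∑ i with x i ≠ 0, b i * x i) ^ 2
      ≤ (∑ i with x i ≠ 0, b i ^ 2) * ∑ i with x i ≠ 0, x i ^ 2 :=
        Finset.sum_mul_sq_le_sq_mul_sq _ _ _
    _ ≤ (k * r) * (k * C ^ 2) := by
        gcongr
        · calc ∑ i with x i ≠ 0, b i ^ 2 ≤ ∑ i with x i ≠ 0, r :=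
              Finset.sum_le_sum fun i _ => hb i
            _ ≤ k * r := by
              rw [Finset.sum_const, nsmul_eq_mul]
              gcongr; exact_mod_cast hx.card_le
        · exact (Finset.sum_le_sum_of_subset_of_nonneg (Finset.filter_subset _ _)
            fun _ _ _ => sq_nonneg _).trans hx.sum_sq_le

/-- The vector `g` of the bilinear form `(x, y) ↦ ∑ₗ vₗ (Nx)ₗ (Ny)ₗ = ⟨x, g⟩`, `N` the noise
operator, restricted to few coordinates. -/
lemma Incoherent.sum_noise_sq_le {n m k : ℕ} {A : Matrix (Fin n) (Fin m) ℝ} {μ σ C ρ : ℝ}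
    (hA : Incoherent A μ) (hσ : dictNorm A ≤ σ) (i₁ : Fin m) {v : Fin m → ℝ}
    (hv : ∀ l, 0 ≤ v l) (hv₁ : v i₁ ≤ C ^ 2) (hvρ : ∀ l, l ≠ i₁ → v l ≤ C ^ 2 * ρ)
    {y : Fin m → ℝ} (hy : Admissible k C y) {S : Finset (Fin m)} (hS : S.card ≤ k) :
    ∑ j ∈ S, noise A i₁ (fun l => v l * noise A i₁ y l) j ^ 2
      ≤ 2 * C ^ 6 * (k * (μ ^ 2 / n)) ^ 2 * k + 2 * C ^ 6 * ρ ^ 2 * σ ^ 8 * k := by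
  set r := μ ^ 2 / (n : ℝ) with hr
  have hr0 : 0 ≤ r := by positivity
  -- The weight of i₁ is not small, so this coordinate is split off and handled by incoherence
  -- alone. The other weights carry a factor ρ and can afford the spectral norm.
  set a := v i₁ * noise A i₁ y i₁ with ha
  set w : Fin m → ℝ := fun j => if j = i₁ then 0 else v j * noise A i₁ y j with hw
  have ha2 : a ^ 2 ≤ C ^ 4 * (k * r * (k * C ^ 2)) := by
    rw [ha, mul_pow, hA.noise_self]
    have h1 : v i₁ ^ 2 ≤ C ^ 4 := by
      calc v i₁ ^ 2 ≤ (C ^ 2) ^ 2 := by gcongr; exact hv _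
        _ = C ^ 4 := by ring
    gcongr
    exact hy.sq_sum_mul_le hr0 fun i => hA.noiseCol_sq_le i₁ i
  have hw2 : ∑ j, w j ^ 2 ≤ (C ^ 2 * ρ) ^ 2 * (σ ^ 4 * (k * C ^ 2)) := by
    calc ∑ j, w j ^ 2 ≤ ∑ j, (C ^ 2 * ρ) ^ 2 * (∑ i, gram A j i * y i) ^ 2 := by
          refine Finset.sum_le_sum fun j _ => ?_
          by_cases hj : j = i₁
          · simp only [hw, hj, if_true, zero_pow two_ne_zero]; positivity
          · simp only [hw, hj, if_false]
            rw [noise_of_ne A hj, mul_pow]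
            gcongr
            · exact hv j
            · exact hvρ j hj
      _ ≤ _ := by
          rw [← Finset.mul_sum]
          gcongr
          exact (sum_gram_mulVec_sq_le hσ y).trans (by gcongr; exact hy.sum_sq_le)
  calc ∑ j ∈ S, noise A i₁ (fun l => v l * noise A i₁ y l) j ^ 2
      ≤ ∑ j ∈ S, (2 * (a ^ 2 * r) + 2 * (∑ i, gram A j i * w i) ^ 2) := by
        refine Finset.sum_le_sum fun j _ => ?_
        rw [hA.noise_eq]
        have h1 : (a * noiseCol A i₁ j) ^ 2 ≤ a ^ 2 * r := by
          rw [mul_pow]; gcongr; exact hA.noiseCol_sq_le i₁ j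
        have h2 := add_sq_le (a := a * noiseCol A i₁ j) (b := ∑ i, gram A j i * w i)
        calc _ ≤ _ := h2
          _ ≤ _ := by linarith
    _ = S.card * (2 * (a ^ 2 * r)) + 2 * ∑ j ∈ S, (∑ i, gram A j i * w i) ^ 2 := by
        rw [Finset.sum_add_distrib, Finset.sum_const, nsmul_eq_mul, Finset.mul_sum]
    _ ≤ k * (2 * (C ^ 4 * (k * r * (k * C ^ 2)) * r))
        + 2 * (σ ^ 4 * ((C ^ 2 * ρ) ^ 2 * (σ ^ 4 * (k * C ^ 2)))) := by
        gcongr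
        exact ((Finset.sum_le_sum_of_subset_of_nonneg (Finset.subset_univ S)
          fun _ _ _ => sq_nonneg _).trans (sum_gram_mulVec_sq_le hσ w)).trans (by gcongr)
    _ = _ := by ring

/-! ### The conditioned law of the seeds -/

lemma integral_le_of_ae_le_indicator {E : Type*} [MeasurableSpace E] {μ : Measure E}
    [IsFiniteMeasure μ] {f : E → ℝ} (hf : Integrable f μ) {s : Set E} (hs : MeasurableSet s)
    {c : ℝ} (h : ∀ᵐ x ∂μ, f x ≤ s.indicator (fun _ => c) x) : ∫ x, f x ∂μ ≤ c * μ.real s := by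
  calc ∫ x, f x ∂μ ≤ ∫ x, s.indicator (fun _ => c) x ∂μ :=
        integral_mono_ae hf ((integrable_const c).indicator hs) h
    _ = c * μ.real s := by
        rw [integral_indicator hs, setIntegral_const, smul_eq_mul, mul_comm]

lemma measurableSet_forall_ne_zero {m : ℕ} (T : Finset (Fin m)) :
    MeasurableSet {x : Fin m → ℝ | ∀ i ∈ T, x i ≠ 0} := by
  have : {x : Fin m → ℝ | ∀ i ∈ T, x i ≠ 0} = ⋂ i ∈ T, {x | x i ≠ 0} := by
    ext; simp
  rw [this]
  exact T.measurableSet_biInter fun i _ =>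
    (measurableSet_eq_fun (measurable_pi_apply i) measurable_const).compl

lemma measurableSet_pos {m : ℕ} (i : Fin m) : MeasurableSet {x : Fin m → ℝ | 0 < x i} :=
  measurableSet_lt measurable_const (measurable_pi_apply i)

/-- The properties of the law of a random seed that are used: its values are admissible and
positive at `i₁`, it is invariant under sign changes of the other coordinates, and these are
nonzero with small probability, also jointly for two of them. -/
structure IsSeedLaw {m : ℕ} (Q : Measure (Fin m → ℝ)) (i₁ : Fin m) (k : ℕ) (C ρ : ℝ) :
    Prop where
  prob : IsProbabilityMeasure Q
  admissible : ∀ᵐ x ∂Q, Admissible k C x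
  pos : ∀ᵐ x ∂Q, 0 < x i₁
  flip : ∀ j, j ≠ i₁ → MeasurePreserving (flipAt j) Q Q
  single : ∀ l, l ≠ i₁ → Q.real {x | x l ≠ 0} ≤ ρ
  pair : ∀ l l', l ≠ i₁ → l' ≠ i₁ → l ≠ l' → Q.real {x | x l ≠ 0 ∧ x l' ≠ 0} ≤ ρ ^ 2

/-- Flipping the sign at i₁ exchanges positive and negative values there and leaves the event on T
unchanged, so positivity halves the probability. -/
lemma measureReal_pos_and {m : ℕ} {V : Measure ℝ} {C : ℝ}
    (hV : IsValueDistribution V C) (D : PMF (Finset (Fin m))) (i₁ : Fin m) {T : Finset (Fin m)}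
    (hT : i₁ ∉ T) :
    (sparseLaw D V).real ({x | 0 < x i₁} ∩ {x | ∀ i ∈ T, x i ≠ 0})
      = marginal D (insert i₁ T) / 2 := by
  have := hV.isProbabilityMeasure
  set s := {x : Fin m → ℝ | 0 < x i₁} ∩ {x | ∀ i ∈ T, x i ≠ 0} with hs
  have hsm : MeasurableSet s := (measurableSet_pos i₁).inter (measurableSet_forall_ne_zero T)
  have hflip := (measurePreserving_flipAt_sparseLaw hV D i₁)
  have h1 : (sparseLaw D V).real (flipAt i₁ ⁻¹' s) = (sparseLaw D V).real s := by
    rw [measureReal_def, hflip.measure_preimage hsm.nullMeasurableSet, measureReal_def]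
  have h2 : {x : Fin m → ℝ | ∀ i ∈ insert i₁ T, x i ≠ 0} = s ∪ flipAt i₁ ⁻¹' s := by
    ext x
    have h3 : (∀ i ∈ T, flipAt i₁ x i ≠ 0) ↔ ∀ i ∈ T, x i ≠ 0 := by
      refine forall₂_congr fun i hi => ?_
      rw [flipAt_of_ne fun h : i = i₁ => hT (h ▸ hi)]
    simp only [hs, Set.mem_ofPred_eq, Set.mem_union, Set.mem_inter_iff, Set.mem_preimage,
      Finset.forall_mem_insert, h3, flipAt_self]
    rw [← or_and_right, neg_pos, ne_iff_lt_or_gt, or_comm]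
  have h4 : Disjoint s (flipAt i₁ ⁻¹' s) := by
    rw [Set.disjoint_left]
    rintro x ⟨hx, -⟩ ⟨hx', -⟩
    simp only [Set.mem_ofPred_eq, flipAt_self] at hx hx'
    linarith
  have h5 := measureReal_forall_ne_zero hV D (insert i₁ T)
  rw [h2, measureReal_union h4 (measurable_flipAt i₁ hsm), h1] at h5
  linarith

lemma IsRandomSupport.measureReal_pos {m k : ℕ} {V : Measure ℝ} {C τ κ : ℝ}
    (hV : IsValueDistribution V C) {R : PMF (Finset (Fin m))}
    (hR : IsRandomSupport R k τ κ) (i₁ : Fin m) (hk : 1 ≤ k) :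
    0 < marginal R {i₁} ∧ (sparseLaw R V).real {x | 0 < x i₁} = marginal R {i₁} / 2 := by
  constructor
  · rw [hR.marginal_eq]
    have : (0 : ℝ) < k := by exact_mod_cast hk
    have := i₁.pos
    positivity
  · simpa using measureReal_pos_and hV R i₁ (T := ∅) (by simp)

lemma IsRandomSupport.cond_pos {m k : ℕ} {V : Measure ℝ} {C τ κ : ℝ}
    (hV : IsValueDistribution V C) (hC : 0 ≤ C) {R : PMF (Finset (Fin m))}
    (hR : IsRandomSupport R k τ κ) (i₁ : Fin m) (hk : 1 ≤ k) :
    IsProbabilityMeasure (cond (sparseLaw R V) {x | 0 < x i₁}) ∧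
    ∀ᵐ x ∂cond (sparseLaw R V) {x | 0 < x i₁}, Admissible k C x ∧ 0 < x i₁ := by
  have := hV.isProbabilityMeasure
  obtain ⟨hpos, hset⟩ := hR.measureReal_pos hV i₁ hk
  have hne : sparseLaw R V {x | 0 < x i₁} ≠ 0 := by
    intro h
    rw [measureReal_def, h] at hset
    simp at hset
    linarith
  exact ⟨cond_isProbabilityMeasure hne,
    Filter.Eventually.and (cond_absolutelyContinuous.ae_le (ae_admissible hV hC hR.sparse))
      (ae_cond_mem (measurableSet_pos i₁))⟩

lemma IsRandomSupport.isSeedLaw {m k : ℕ} {V : Measure ℝ} {C τ κ : ℝ}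
    (hV : IsValueDistribution V C) (hC : 0 ≤ C) {R : PMF (Finset (Fin m))}
    (hR : IsRandomSupport R k τ κ) (i₁ : Fin m) (hk : 1 ≤ k) (hτ : 0 ≤ τ)
    (hκ : 2 ≤ κ * Real.log m) :
    IsSeedLaw (cond (sparseLaw R V) {x | 0 < x i₁}) i₁ k C (τ * (k / m)) := by
  obtain ⟨hpos, hset⟩ := hR.measureReal_pos hV i₁ hk
  obtain ⟨hprob, hae⟩ := hR.cond_pos hV hC i₁ hk
  have hreal : ∀ T : Finset (Fin m), i₁ ∉ T →
      (cond (sparseLaw R V) {x | 0 < x i₁}).real {x | ∀ i ∈ T, x i ≠ 0}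
        = marginal R (insert i₁ T) / marginal R {i₁} := by
    intro T hT
    rw [measureReal_def, cond_apply (measurableSet_pos i₁), ENNReal.toReal_mul,
      ENNReal.toReal_inv, ← measureReal_def, ← measureReal_def, hset,
      measureReal_pos_and hV R i₁ hT]
    field_simp
  -- Two conditioning indices are enough: i₁ itself and one more for the joint bound. This is the
  -- only use of κ log m ≥ 2.
  have hcorr : ∀ (i : Fin m) (T : Finset (Fin m)), i ∉ T → T.card ≤ 2 →
      marginal R (insert i T) ≤ τ * ((k : ℝ) / m) * marginal R T := by
    intro i T hi hT
    refine hR.negCorrelated i T hi (le_trans ?_ hκ)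
    exact_mod_cast hT
  refine ⟨hprob, hae.mono fun _ h => h.1, hae.mono fun _ h => h.2, ?_, ?_, ?_⟩
  · intro j hj
    have h := (measurePreserving_flipAt_sparseLaw hV R j).restrict_preimage
      (measurableSet_pos i₁)
    have hpre : flipAt j ⁻¹' {x : Fin m → ℝ | 0 < x i₁} = {x | 0 < x i₁} := by
      ext x; simp [flipAt_of_ne hj.symm]
    rw [hpre] at h
    refine ⟨h.measurable, ?_⟩
    rw [ProbabilityTheory.cond, Measure.map_smul, h.map_eq]
  · intro l hl
    have h := hreal {l} (by simpa using hl.symm)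
    simp only [Finset.mem_singleton, forall_eq] at h
    rw [h, div_le_iff₀ hpos, Finset.pair_comm]
    exact hcorr l {i₁} (by simpa using hl) (by simp)
  · intro l l' hl hl' hll
    have h := hreal {l, l'} (by simp [hl.symm, hl'.symm])
    simp only [Finset.mem_insert, Finset.mem_singleton, forall_eq_or_imp, forall_eq] at h
    rw [h, div_le_iff₀ hpos]
    have h1 := hcorr l {i₁} (by simpa using hl) (by simp)
    have h2 := hcorr l' {i₁, l} (by simp [hl', hll.symm]) Finset.card_le_two
    have h3 : ({i₁, l, l'} : Finset (Fin m)) = {l', i₁, l} := by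
      ext; simp only [Finset.mem_insert, Finset.mem_singleton]; tauto
    have h4 : ({i₁, l} : Finset (Fin m)) = {l, i₁} := Finset.pair_comm _ _
    have h5 : (0 : ℝ) ≤ τ * (k / m) := by positivity
    rw [h3]
    calc _ ≤ _ := h2
      _ ≤ τ * (k / m) * (τ * (k / m) * marginal R {i₁}) := by
        rw [h4]; gcongr
      _ = _ := by ring

/-! ### Moments of a single seed -/

section SeedLaw

variable {m k : ℕ} {Q : Measure (Fin m → ℝ)} {i₁ : Fin m} {C ρ : ℝ}

lemma IsSeedLaw.integrable (hQ : IsSeedLaw Q i₁ k C ρ) {f : (Fin m → ℝ) → ℝ}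
    (hf : Continuous f) : Integrable f Q :=
  have := hQ.prob
  integrable_of_continuous (isCompact_box m C) (hQ.admissible.mono fun _ h => h.mem_box) hf

lemma IsSeedLaw.integral_mul_eq_zero (hQ : IsSeedLaw Q i₁ k C ρ) {l l' : Fin m} (h : l ≠ l') :
    ∫ x, x l * x l' ∂Q = 0 := by
  by_cases hl : l = i₁
  · exact integral_eq_zero_of_flipAt (hQ.flip l' (fun h' => h (hl.trans h'.symm))) fun x => by
      rw [flipAt_self, flipAt_of_ne h]; ring
  · exact integral_eq_zero_of_flipAt (hQ.flip l hl) fun x => by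
      rw [flipAt_self, flipAt_of_ne h.symm]; ring

lemma IsSeedLaw.integral_sq_le (hQ : IsSeedLaw Q i₁ k C ρ) (l : Fin m) :
    ∫ x, x l ^ 2 ∂Q ≤ C ^ 2 := by
  have := hQ.prob
  calc ∫ x, x l ^ 2 ∂Q ≤ ∫ _, C ^ 2 ∂Q := by
        refine integral_mono_ae (hQ.integrable (by fun_prop)) (integrable_const _) ?_
        filter_upwards [hQ.admissible] with x hx
        rw [← sq_abs]
        have := hx.abs_le l
        gcongr
    _ = C ^ 2 := by simp

lemma IsSeedLaw.integral_sq_le_of_ne (hQ : IsSeedLaw Q i₁ k C ρ) {l : Fin m} (hl : l ≠ i₁) :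
    ∫ x, x l ^ 2 ∂Q ≤ C ^ 2 * ρ := by
  have := hQ.prob
  have hs : MeasurableSet {x : Fin m → ℝ | x l ≠ 0} := by
    simpa using measurableSet_forall_ne_zero {l}
  refine (integral_le_of_ae_le_indicator (hQ.integrable (by fun_prop)) hs (c := C ^ 2) ?_).trans
    (mul_le_mul_of_nonneg_left (hQ.single l hl) (sq_nonneg C))
  filter_upwards [hQ.admissible] with x hx
  by_cases h : x l = 0
  · simp [h]
  · rw [Set.indicator_of_mem (show x ∈ {x : Fin m → ℝ | x l ≠ 0} from h), ← sq_abs]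
    have := hx.abs_le l
    gcongr

lemma IsSeedLaw.integral_abs_le_of_ne (hQ : IsSeedLaw Q i₁ k C ρ) (hC : 0 ≤ C) {l : Fin m}
    (hl : l ≠ i₁) : ∫ x, |x l| ∂Q ≤ C * ρ := by
  have := hQ.prob
  have hs : MeasurableSet {x : Fin m → ℝ | x l ≠ 0} := by
    simpa using measurableSet_forall_ne_zero {l}
  refine (integral_le_of_ae_le_indicator (hQ.integrable (by fun_prop)) hs (c := C) ?_).trans
    (mul_le_mul_of_nonneg_left (hQ.single l hl) hC)
  filter_upwards [hQ.admissible] with x hx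
  by_cases h : x l = 0
  · simp [h]
  · rw [Set.indicator_of_mem (show x ∈ {x : Fin m → ℝ | x l ≠ 0} from h)]
    exact hx.abs_le l

lemma IsSeedLaw.integral_sq_mul_sq_le (hQ : IsSeedLaw Q i₁ k C ρ) {l l' : Fin m} (hl : l ≠ i₁)
    (hl' : l' ≠ i₁) (h : l ≠ l') : ∫ x, x l ^ 2 * x l' ^ 2 ∂Q ≤ C ^ 4 * ρ ^ 2 := by
  have := hQ.prob
  have hs : MeasurableSet {x : Fin m → ℝ | x l ≠ 0 ∧ x l' ≠ 0} := by
    simpa using measurableSet_forall_ne_zero {l, l'}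
  refine (integral_le_of_ae_le_indicator (hQ.integrable (by fun_prop)) hs (c := C ^ 4) ?_).trans
    (mul_le_mul_of_nonneg_left (hQ.pair l l' hl hl' h) (by positivity))
  filter_upwards [hQ.admissible] with x hx
  by_cases h : x ∈ {x : Fin m → ℝ | x l ≠ 0 ∧ x l' ≠ 0}
  · rw [Set.indicator_of_mem h, ← sq_abs, ← sq_abs (x l')]
    have h1 := hx.abs_le l
    have h2 := hx.abs_le l'
    calc |x l| ^ 2 * |x l'| ^ 2 ≤ C ^ 2 * C ^ 2 := by gcongr
      _ = _ := by ring
  · rw [Set.indicator_of_notMem h]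
    simp only [Set.mem_ofPred_eq, not_and_or, not_not] at h
    rcases h with h | h <;> simp [h]

/-- The second moments of linear forms in the seed. -/
lemma IsSeedLaw.integral_dot_mul_dot (hQ : IsSeedLaw Q i₁ k C ρ) (a b : Fin m → ℝ) :
    ∫ x, (∑ l, x l * a l) * (∑ l, x l * b l) ∂Q = ∑ l, (∫ x, x l ^ 2 ∂Q) * (a l * b l) := by
  have h1 : ∀ x : Fin m → ℝ, (∑ l, x l * a l) * (∑ l, x l * b l)
      = ∑ l, ∑ l', (a l * b l') * (x l * x l') := by
    intro x
    rw [Finset.sum_mul_sum]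
    exact Finset.sum_congr rfl fun _ _ => Finset.sum_congr rfl fun _ _ => by ring
  simp_rw [h1]
  rw [integral_finsetSum _ fun l _ => hQ.integrable (by fun_prop)]
  refine Finset.sum_congr rfl fun l _ => ?_
  rw [integral_finsetSum _ fun l _ => hQ.integrable (by fun_prop), Finset.sum_eq_single l]
  · rw [integral_const_mul, mul_comm]
    simp_rw [sq]
  · intro l' _ hl'
    rw [integral_const_mul, hQ.integral_mul_eq_zero hl'.symm, mul_zero]
  · simp

end SeedLaw

/-! ### The multilinear expansion of the statistic -/

@[fun_prop]
lemma continuous_noise {n m : ℕ} (A : Matrix (Fin n) (Fin m) ℝ) (i₁ : Fin m) :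
    Continuous (noise A i₁) := by
  unfold noise
  refine continuous_pi fun l => ?_
  split_ifs <;> fun_prop

/-- The coefficient vector of the part of the statistic in which exactly the factors in `T`
contribute their noise. -/
def noiseMoment {n m N : ℕ} (A : Matrix (Fin n) (Fin m) ℝ) (P : Measure (Fin m → ℝ))
    (i₁ : Fin m) (T : Finset (Fin N)) (ζ : Fin N → Fin m → ℝ) (i : Fin m) : ℝ :=
  ∫ x, x i₁ ^ (N - T.card) * (∏ t ∈ T, ∑ l, ζ t l * noise A i₁ x l) * x i ∂P

lemma integrable_sparseLaw {m k : ℕ} {D : PMF (Finset (Fin m))} {V : Measure ℝ} {C : ℝ}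
    (hV : IsValueDistribution V C) (hC : 0 ≤ C) (hD : IsSparse D k) {f : (Fin m → ℝ) → ℝ}
    (hf : Continuous f) : Integrable f (sparseLaw D V) :=
  have := hV.isProbabilityMeasure
  integrable_of_continuous (isCompact_box m C)
    ((ae_admissible hV hC hD).mono fun _ h => h.mem_box) hf

lemma statistic_eq_sum {n m k N : ℕ} (A : Matrix (Fin n) (Fin m) ℝ) {D : PMF (Finset (Fin m))}
    {V : Measure ℝ} {C : ℝ} (hV : IsValueDistribution V C) (hC : 0 ≤ C) (hD : IsSparse D k)
    (i₁ : Fin m) (ζ : Fin N → Fin m → ℝ) :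
    statistic A D V ζ = ∑ T : Finset (Fin N),
      (∏ t ∈ Tᶜ, ζ t i₁) • synth A (noiseMoment A (sparseLaw D V) i₁ T ζ) := by
  have hpt : ∀ x : Fin m → ℝ, (∏ t, inner ℝ (synth A (ζ t)) (synth A x)) • synth A x
      = ∑ T : Finset (Fin N), ∑ i, ((∏ t ∈ Tᶜ, ζ t i₁) * (x i₁ ^ (N - T.card)
          * (∏ t ∈ T, ∑ l, ζ t l * noise A i₁ x l) * x i)) • column A i := by
    intro x
    simp_rw [inner_synth_synth_eq A i₁]
    simp_rw [add_comm (_ * x i₁)]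
    rw [Finset.prod_add, Finset.powerset_univ, Finset.sum_smul]
    refine Finset.sum_congr rfl fun T _ => ?_
    rw [synth_eq_sum, Finset.smul_sum]
    refine Finset.sum_congr rfl fun i _ => ?_
    rw [smul_smul, ← Finset.compl_eq_univ_sdiff, Finset.prod_mul_distrib, Finset.prod_const,
      Finset.card_compl, Fintype.card_fin]
    congr 1; ring
  have hint : ∀ (T : Finset (Fin N)) (i : Fin m), Integrable (fun x : Fin m → ℝ =>
      (∏ t ∈ Tᶜ, ζ t i₁) * (x i₁ ^ (N - T.card)
          * (∏ t ∈ T, ∑ l, ζ t l * noise A i₁ x l) * x i)) (sparseLaw D V) :=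
    fun T i => integrable_sparseLaw hV hC hD (by fun_prop)
  unfold statistic
  simp_rw [hpt]
  rw [integral_finsetSum _ fun T _ => integrable_finsetSum _ fun i _ => (hint T i).smul_const _]
  refine Finset.sum_congr rfl fun T _ => ?_
  rw [integral_finsetSum _ fun i _ => (hint T i).smul_const _, synth_eq_sum, Finset.smul_sum]
  refine Finset.sum_congr rfl fun i _ => ?_
  rw [integral_smul_const, integral_const_mul, smul_smul, noiseMoment]

/-! ### Second moments of the expansion coefficients -/

lemma ae_pi_forall {N : ℕ} {E : Type*} [MeasurableSpace E] {Q : Measure E}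
    [IsProbabilityMeasure Q] {p : E → Prop} (h : ∀ᵐ x ∂Q, p x) :
    ∀ᵐ ζ ∂Measure.pi (fun _ : Fin N => Q), ∀ t, p (ζ t) :=
  ae_all_iff.2 fun _ => Measure.tendsto_eval_ae_ae.eventually h

lemma integrable_prod_of_continuous {E F : Type*} [TopologicalSpace E] [MeasurableSpace E]
    [TopologicalSpace F] [MeasurableSpace F] [OpensMeasurableSpace (E × F)]
    {μ : Measure E} {ν : Measure F} [IsFiniteMeasure μ] [IsFiniteMeasure ν] {s : Set E}
    {t : Set F} (hs : IsCompact s) (ht : IsCompact t) (hμ : ∀ᵐ x ∂μ, x ∈ s)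
    (hν : ∀ᵐ x ∂ν, x ∈ t) {f : E × F → ℝ} (hf : Continuous f) :
    Integrable f (μ.prod ν) := by
  refine integrable_of_continuous (hs.prod ht) ?_ hf
  filter_upwards [Measure.quasiMeasurePreserving_fst.ae hμ,
    Measure.quasiMeasurePreserving_snd.ae hν] with z h1 h2
  exact ⟨h1, h2⟩

/-- The square of an integral in x is an integral over two independent copies. After exchanging it
with the integral over the seeds, independence factorises the latter: each t in T contributes the
same covariance of two linear forms, which is diagonal because the seed coordinates are
uncorrelated. -/
lemma integral_sum_noiseMoment_sq {n m k N : ℕ} (A : Matrix (Fin n) (Fin m) ℝ)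
    {P Q : Measure (Fin m → ℝ)} [IsProbabilityMeasure P] {i₁ : Fin m} {C ρ : ℝ}
    (hP : ∀ᵐ x ∂P, Admissible k C x) (hQ : IsSeedLaw Q i₁ k C ρ) (T : Finset (Fin N)) :
    Integrable (fun ζ => ∑ i, noiseMoment A P i₁ T ζ i ^ 2) (Measure.pi fun _ : Fin N => Q) ∧
    ∫ ζ, ∑ i, noiseMoment A P i₁ T ζ i ^ 2 ∂Measure.pi (fun _ : Fin N => Q)
      = ∫ z, (z.1 i₁ * z.2 i₁) ^ (N - T.card) * (∑ i, z.1 i * z.2 i)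
          * (∑ l, (∫ x, x l ^ 2 ∂Q) * (noise A i₁ z.1 l * noise A i₁ z.2 l)) ^ T.card
          ∂P.prod P := by
  have := hQ.prob
  set F : (Fin N → Fin m → ℝ) → (Fin m → ℝ) × (Fin m → ℝ) → ℝ := fun ζ z =>
    (z.1 i₁ * z.2 i₁) ^ (N - T.card) * (∑ i, z.1 i * z.2 i)
      * ∏ t ∈ T, (∑ l, ζ t l * noise A i₁ z.1 l) * (∑ l, ζ t l * noise A i₁ z.2 l) with hF
  have hbP : ∀ᵐ x ∂P, x ∈ box m C := hP.mono fun _ h => h.mem_box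
  have hbQ : ∀ᵐ ζ ∂Measure.pi (fun _ : Fin N => Q), ζ ∈ Set.univ.pi fun _ => box m C := by
    filter_upwards [ae_pi_forall (N := N) hQ.admissible] with ζ h
    exact fun t _ => (h t).mem_box
  have hcN : IsCompact (Set.univ.pi fun _ : Fin N => box m C) :=
    isCompact_univ_pi fun _ => isCompact_box m C
  have hbPP : ∀ᵐ z ∂P.prod P, z ∈ box m C ×ˢ box m C := by
    filter_upwards [Measure.quasiMeasurePreserving_fst.ae hbP,
      Measure.quasiMeasurePreserving_snd.ae hbP] with z h1 h2
    exact ⟨h1, h2⟩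
  have h1 : ∀ ζ, ∑ i, noiseMoment A P i₁ T ζ i ^ 2 = ∫ z, F ζ z ∂P.prod P := by
    intro ζ
    have h2 : ∀ z, F ζ z = ∑ i, (z.1 i₁ ^ (N - T.card)
        * (∏ t ∈ T, ∑ l, ζ t l * noise A i₁ z.1 l) * z.1 i)
        * (z.2 i₁ ^ (N - T.card) * (∏ t ∈ T, ∑ l, ζ t l * noise A i₁ z.2 l) * z.2 i) := by
      intro z
      simp only [hF]
      rw [Finset.mul_sum, Finset.sum_mul, Finset.prod_mul_distrib]
      refine Finset.sum_congr rfl fun i _ => ?_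
      rw [mul_pow]; ring
    simp_rw [h2]
    rw [integral_finsetSum _ fun i _ => integrable_of_continuous
      ((isCompact_box m C).prod (isCompact_box m C)) hbPP (by fun_prop)]
    refine Finset.sum_congr rfl fun i _ => ?_
    rw [integral_prod_mul (fun x : Fin m → ℝ => x i₁ ^ (N - T.card)
        * (∏ t ∈ T, ∑ l, ζ t l * noise A i₁ x l) * x i)
      (fun x : Fin m → ℝ => x i₁ ^ (N - T.card)
        * (∏ t ∈ T, ∑ l, ζ t l * noise A i₁ x l) * x i), noiseMoment, sq]
  have hFint : Integrable (Function.uncurry F) ((Measure.pi fun _ : Fin N => Q).prod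
      (P.prod P)) :=
    integrable_prod_of_continuous hcN ((isCompact_box m C).prod (isCompact_box m C))
      hbQ hbPP (by simp only [hF, Function.uncurry_def]; fun_prop)
  simp_rw [h1]
  refine ⟨hFint.integral_prod_left, ?_⟩
  rw [integral_integral_swap hFint]
  · refine integral_congr_ae (Filter.Eventually.of_forall fun z => ?_)
    simp only [hF]
    rw [integral_const_mul]
    congr 1
    have h3 : ∀ ζ : Fin N → Fin m → ℝ,
        ∏ t ∈ T, (∑ l, ζ t l * noise A i₁ z.1 l) * (∑ l, ζ t l * noise A i₁ z.2 l)
        = ∏ t, if t ∈ T then (∑ l, ζ t l * noise A i₁ z.1 l) * (∑ l, ζ t l * noise A i₁ z.2 l)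
          else 1 := by
      intro ζ
      rw [Finset.prod_ite_mem, Finset.univ_inter]
    simp_rw [h3]
    rw [integral_fintype_prod_eq_prod (fun t (x : Fin m → ℝ) => if t ∈ T then
      (∑ l, x l * noise A i₁ z.1 l) * (∑ l, x l * noise A i₁ z.2 l) else 1)]
    rw [← hQ.integral_dot_mul_dot, ← Finset.prod_const, ← Finset.univ_inter T,
      ← Finset.prod_ite_mem, Finset.univ_inter]
    refine Finset.prod_congr rfl fun t _ => ?_
    split_ifs
    · rfl
    · simp

/-- Almost surely x i ≠ 0 means that i lies in the support. Khintchine's bound given the support is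
uniform over supports of size at most k, so averaging over those containing i just multiplies it by
the marginal. -/
lemma integral_indicator_abs_dot_pow_le {m k : ℕ} {V : Measure ℝ} {C : ℝ}
    (hV : IsValueDistribution V C) (hC : 0 < C) {D : PMF (Finset (Fin m))} (hD : IsSparse D k)
    (g : Fin m → ℝ) {b : ℝ} (hb : 0 < b)
    (hg : ∀ S : Finset (Fin m), S.card ≤ k → ∑ i ∈ S, g i ^ 2 ≤ b ^ 2) (d : ℕ) (i : Fin m) :
    ∫ x, {x : Fin m → ℝ | x i ≠ 0}.indicator (fun x => |∑ j, x j * g j| ^ d) x ∂sparseLaw D V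
      ≤ marginal D {i} * (d.factorial * (2 * Real.exp (1 / 2)) * (C * b) ^ d) := by
  have := hV.isProbabilityMeasure
  have hs : MeasurableSet {x : Fin m → ℝ | x i ≠ 0} := by
    simpa using measurableSet_forall_ne_zero {i}
  have hint : ∀ S, Integrable (fun x : Fin m → ℝ => |∑ j, x j * g j| ^ d) (supportLaw V S) := by
    intro S
    refine integrable_of_continuous (isCompact_box m C) ?_ (by fun_prop)
    filter_upwards [ae_supportLaw hV S] with x hx
    refine mem_box.2 fun i => ?_
    by_cases hi : i ∈ S
    · exact ((hx i).1 hi).2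
    · rw [(hx i).2 hi]; simpa using hC.le
  rw [integral_sparseLaw D V fun S => (hint S).indicator hs, marginal, Finset.sum_filter,
    Finset.sum_mul]
  refine Finset.sum_le_sum fun S _ => ?_
  by_cases hS : S ∈ D.support
  · simp only [Finset.singleton_subset_iff]
    split_ifs with hi
    · gcongr
      refine (integral_mono ((hint S).indicator hs) (hint S) fun x => ?_).trans
        (integral_abs_dot_pow_supportLaw_le hV hC S g hb (hg S (hD S hS)) d)
      exact Set.indicator_le_self' (fun _ _ => by positivity) x
    · rw [integral_eq_zero_of_ae]
      · simp
      · filter_upwards [ae_supportLaw hV S] with x hx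
        refine Set.indicator_of_notMem ?_ _
        simp [(hx i).2 hi]
  · rw [PMF.mem_support_iff, not_not] at hS
    simp [hS]

lemma measureReal_ne_zero {m : ℕ} {V : Measure ℝ} {C : ℝ}
    (hV : IsValueDistribution V C) (D : PMF (Finset (Fin m))) (i : Fin m) :
    (sparseLaw D V).real {x | x i ≠ 0} = marginal D {i} := by
  simpa using measureReal_forall_ne_zero hV D {i}

/-- Two independent copies of a sparse vector: moments of a bilinear form, weighted by the
coincidences of the supports. -/
lemma integral_prod_mul_dot_pow_le {m k : ℕ} {V : Measure ℝ} {C : ℝ}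
    (hV : IsValueDistribution V C) (hC : 0 < C) {D : PMF (Finset (Fin m))} (hD : IsSparse D k)
    {φ : (Fin m → ℝ) × (Fin m → ℝ) → ℝ} (hφ : Continuous φ)
    {g : (Fin m → ℝ) → Fin m → ℝ} (hgc : Continuous g) {b : ℝ} (hb : 0 < b)
    (hg : ∀ y, Admissible k C y → ∀ S : Finset (Fin m), S.card ≤ k →
      ∑ i ∈ S, g y i ^ 2 ≤ b ^ 2)
    {ω : Fin m → ℝ} (hω : ∀ i, 0 ≤ ω i)
    (hφω : ∀ y x, Admissible k C y → Admissible k C x →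
      |φ (y, x)| ≤ ∑ i, if y i ≠ 0 ∧ x i ≠ 0 then ω i else 0) (d : ℕ) :
    ∫ z, φ z * (∑ j, z.2 j * g z.1 j) ^ d ∂(sparseLaw D V).prod (sparseLaw D V)
      ≤ (∑ i, ω i * marginal D {i} ^ 2)
        * (d.factorial * (2 * Real.exp (1 / 2)) * (C * b) ^ d) := by
  have := hV.isProbabilityMeasure
  set M : ℝ := d.factorial * (2 * Real.exp (1 / 2)) * (C * b) ^ d with hM
  set P := sparseLaw D V with hP
  have hadm : ∀ᵐ x ∂P, Admissible k C x := ae_admissible hV hC.le hD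
  have hs : ∀ i, MeasurableSet {x : Fin m → ℝ | x i ≠ 0} := fun i => by
    simpa using measurableSet_forall_ne_zero {i}
  have hint : Integrable (fun z => φ z * (∑ j, z.2 j * g z.1 j) ^ d) (P.prod P) :=
    integrable_prod_of_continuous (isCompact_box m C) (isCompact_box m C)
      (hadm.mono fun _ h => h.mem_box) (hadm.mono fun _ h => h.mem_box) (by fun_prop)
  rw [integral_prod _ hint]
  -- With y frozen the bilinear form is linear in x. A coincidence at i produces one marginal here,
  -- from x, and a second one when y is integrated.
  have hinner : ∀ᵐ y ∂P, ∫ x, φ (y, x) * (∑ j, x j * g y j) ^ d ∂P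
      ≤ ∑ i, {y : Fin m → ℝ | y i ≠ 0}.indicator (fun _ => ω i * (marginal D {i} * M)) y := by
    filter_upwards [hadm] with y hy
    have hi : ∀ i, Integrable (fun x => {x : Fin m → ℝ | x i ≠ 0}.indicator
        (fun x => |∑ j, x j * g y j| ^ d) x) P := fun i =>
      (integrable_sparseLaw hV hC.le hD (by fun_prop)).indicator (hs i)
    calc ∫ x, φ (y, x) * (∑ j, x j * g y j) ^ d ∂P
        ≤ ∫ x, ∑ i, (if y i ≠ 0 then ω i else 0) * {x : Fin m → ℝ | x i ≠ 0}.indicator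
            (fun x => |∑ j, x j * g y j| ^ d) x ∂P := by
          refine integral_mono_ae (integrable_sparseLaw hV hC.le hD (by fun_prop))
            (integrable_finsetSum _ fun i _ => (hi i).const_mul _) ?_
          filter_upwards [hadm] with x hx
          calc φ (y, x) * (∑ j, x j * g y j) ^ d
              ≤ |φ (y, x) * (∑ j, x j * g y j) ^ d| := le_abs_self _
            _ = |φ (y, x)| * |∑ j, x j * g y j| ^ d := by rw [abs_mul, abs_pow]
            _ ≤ (∑ i, if y i ≠ 0 ∧ x i ≠ 0 then ω i else 0) * |∑ j, x j * g y j| ^ d := by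
              gcongr; exact hφω y x hy hx
            _ = _ := by
              rw [Finset.sum_mul]
              refine Finset.sum_congr rfl fun i _ => ?_
              by_cases h1 : y i = 0 <;> by_cases h2 : x i = 0 <;> simp [h1, h2]
      _ = ∑ i, (if y i ≠ 0 then ω i else 0) * ∫ x, {x : Fin m → ℝ | x i ≠ 0}.indicator
            (fun x => |∑ j, x j * g y j| ^ d) x ∂P := by
          rw [integral_finsetSum _ fun i _ => (hi i).const_mul _]
          exact Finset.sum_congr rfl fun i _ => integral_const_mul _ _
      _ ≤ _ := by
          refine Finset.sum_le_sum fun i _ => ?_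
          have h := integral_indicator_abs_dot_pow_le hV hC hD (g y) hb (hg y hy) d i
          by_cases h1 : y i = 0
          · simp [h1]
          · rw [if_pos h1, Set.indicator_of_mem (show y ∈ {y : Fin m → ℝ | y i ≠ 0} from h1)]
            exact mul_le_mul_of_nonneg_left h (hω i)
  calc _ ≤ ∫ y, ∑ i, {y : Fin m → ℝ | y i ≠ 0}.indicator
        (fun _ => ω i * (marginal D {i} * M)) y ∂P :=
        integral_mono_ae hint.integral_prod_left
          (integrable_finsetSum _ fun i _ => (integrable_const _).indicator (hs i)) hinner
    _ = ∑ i, ω i * (marginal D {i} * M) * marginal D {i} := by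
        rw [integral_finsetSum _ fun i _ => (integrable_const _).indicator (hs i)]
        refine Finset.sum_congr rfl fun i _ => ?_
        rw [integral_indicator (hs i), setIntegral_const, smul_eq_mul, hP,
          measureReal_ne_zero hV, mul_comm]
    _ = _ := by
        rw [Finset.sum_mul]
        exact Finset.sum_congr rfl fun i _ => by ring

/-- Self-adjointness of the noise operator Z moves it from x onto the weighted vector v · Zy. This
exhibits the covariance form as a linear form in x, with coefficients independent of x. -/
lemma integral_sum_noiseMoment_sq_le {n m k N : ℕ} {A : Matrix (Fin n) (Fin m) ℝ}
    {μ σ C ρ b : ℝ} (hA : Incoherent A μ) (hσ : dictNorm A ≤ σ) {V : Measure ℝ}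
    (hV : IsValueDistribution V C) (hC : 0 < C) {D : PMF (Finset (Fin m))} (hD : IsSparse D k)
    {i₁ : Fin m} {Q : Measure (Fin m → ℝ)} (hQ : IsSeedLaw Q i₁ k C ρ) (T : Finset (Fin N))
    (hb : 0 < b) (hb2 : 2 * C ^ 6 * (k * (μ ^ 2 / n)) ^ 2 * k + 2 * C ^ 6 * ρ ^ 2 * σ ^ 8 * k
      ≤ b ^ 2) {ω : Fin m → ℝ} (hω : ∀ i, 0 ≤ ω i)
    (hφω : ∀ y x : Fin m → ℝ, Admissible k C y → Admissible k C x →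
      |(y i₁ * x i₁) ^ (N - T.card) * ∑ i, y i * x i|
        ≤ ∑ i, if y i ≠ 0 ∧ x i ≠ 0 then ω i else 0) :
    Integrable (fun ζ => ∑ i, noiseMoment A (sparseLaw D V) i₁ T ζ i ^ 2)
      (Measure.pi fun _ : Fin N => Q) ∧
    ∫ ζ, ∑ i, noiseMoment A (sparseLaw D V) i₁ T ζ i ^ 2 ∂Measure.pi (fun _ : Fin N => Q)
      ≤ (∑ i, ω i * marginal D {i} ^ 2)
        * (T.card.factorial * (2 * Real.exp (1 / 2)) * (C * b) ^ T.card) := by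
  have := hV.isProbabilityMeasure
  obtain ⟨hint, heq⟩ := integral_sum_noiseMoment_sq A (ae_admissible hV hC.le hD) hQ T
  refine ⟨hint, ?_⟩
  rw [heq]
  set v : Fin m → ℝ := fun l => ∫ x, x l ^ 2 ∂Q
  have hH : ∀ y x : Fin m → ℝ,
      ∑ l, (∫ x, x l ^ 2 ∂Q) * (noise A i₁ y l * noise A i₁ x l)
      = ∑ j, x j * noise A i₁ (fun l => v l * noise A i₁ y l) j := by
    intro y x
    rw [sum_mul_noise_comm]
    exact Finset.sum_congr rfl fun l _ => by ring
  simp_rw [hH]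
  refine integral_prod_mul_dot_pow_le (φ := fun z => (z.1 i₁ * z.2 i₁) ^ (N - T.card)
      * ∑ i, z.1 i * z.2 i) (g := fun y => noise A i₁ (fun l => v l * noise A i₁ y l))
    hV hC hD (by fun_prop) (by fun_prop) hb (fun y hy S hS => ?_) hω hφω _
  exact (hA.sum_noise_sq_le hσ i₁ (fun l => integral_nonneg fun x => sq_nonneg _)
    (hQ.integral_sq_le i₁) (fun l hl => hQ.integral_sq_le_of_ne hl) hy hS).trans hb2

/-! ### The terms with at most one noise factor -/

section LowOrder

variable {n m k N : ℕ} {V : Measure ℝ} {C : ℝ} {D : PMF (Finset (Fin m))}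

lemma synth_noiseMoment_empty (A : Matrix (Fin n) (Fin m) ℝ) (hV : IsValueDistribution V C)
    (i₁ : Fin m) (ζ : Fin N → Fin m → ℝ) :
    synth A (noiseMoment A (sparseLaw D V) i₁ ∅ ζ) = moment D V i₁ (N + 1) • column A i₁ := by
  rw [synth_eq_sum, Finset.sum_eq_single i₁]
  · simp [noiseMoment, moment, pow_succ]
  · intro i _ hi
    rw [noiseMoment, integral_eq_zero_of_flipAt (measurePreserving_flipAt_sparseLaw hV D i),
      zero_smul]
    intro x
    rw [flipAt_self, flipAt_of_ne hi.symm]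
    simp
  · simp

/-- The weights of the coordinates in the terms with one noise factor. -/
def coupling (D : PMF (Finset (Fin m))) (V : Measure ℝ) (i₁ : Fin m) (N : ℕ) (i : Fin m) : ℝ :=
  ∫ x, x i₁ ^ (N - 1) * x i ^ 2 ∂sparseLaw D V

/-- Only j = i survives in the expansion of the noise factor. For j ≠ i the integrand is odd in x_i
if j = i₁ and odd in x_j otherwise, so the parity of N plays no role. -/
lemma noiseMoment_singleton (A : Matrix (Fin n) (Fin m) ℝ) (hV : IsValueDistribution V C)
    (hC : 0 ≤ C) (hD : IsSparse D k) (i₁ : Fin m) (t : Fin N) (ζ : Fin N → Fin m → ℝ)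
    (i : Fin m) :
    noiseMoment A (sparseLaw D V) i₁ {t} ζ i = coupling D V i₁ N i * noise A i₁ (ζ t) i := by
  have h1 : ∀ x : Fin m → ℝ, x i₁ ^ (N - 1) * (∑ l, ζ t l * noise A i₁ x l) * x i
      = ∑ j, noise A i₁ (ζ t) j * (x i₁ ^ (N - 1) * (x j * x i)) := by
    intro x
    rw [sum_mul_noise_comm, Finset.mul_sum, Finset.sum_mul]
    exact Finset.sum_congr rfl fun j _ => by ring
  simp only [noiseMoment, Finset.card_singleton, Finset.prod_singleton, h1]
  rw [integral_finsetSum _ fun j _ => integrable_sparseLaw hV hC hD (by fun_prop),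
    Finset.sum_eq_single i]
  · rw [integral_const_mul, coupling, mul_comm]
    simp_rw [sq]
  · intro j _ hj
    rw [integral_const_mul]
    by_cases hj₁ : j = i₁
    · rw [integral_eq_zero_of_flipAt (measurePreserving_flipAt_sparseLaw hV D i), mul_zero]
      intro x
      rw [flipAt_self, flipAt_of_ne hj, flipAt_of_ne (hj₁ ▸ hj)]
      ring
    · rw [integral_eq_zero_of_flipAt (measurePreserving_flipAt_sparseLaw hV D j), mul_zero]
      intro x
      rw [flipAt_self, flipAt_of_ne hj.symm, flipAt_of_ne (Ne.symm hj₁)]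
      ring
  · simp

lemma measurableSet_ne_zero_and (i₁ i : Fin m) :
    MeasurableSet {x : Fin m → ℝ | x i₁ ≠ 0 ∧ x i ≠ 0} := by
  simpa using measurableSet_forall_ne_zero {i₁, i}

lemma abs_coupling_le (hV : IsValueDistribution V C) (hC : 0 ≤ C) (hD : IsSparse D k)
    (i₁ : Fin m) (hN : 2 ≤ N) (i : Fin m) :
    |coupling D V i₁ N i| ≤ C ^ (N + 1) * (sparseLaw D V).real {x | x i₁ ≠ 0 ∧ x i ≠ 0} := by
  have := hV.isProbabilityMeasure
  refine abs_integral_le_integral_abs.trans (integral_le_of_ae_le_indicator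
    (integrable_sparseLaw hV hC hD (by fun_prop)) (measurableSet_ne_zero_and i₁ i) ?_)
  filter_upwards [ae_admissible hV hC hD] with x hx
  by_cases h : x ∈ {x : Fin m → ℝ | x i₁ ≠ 0 ∧ x i ≠ 0}
  · rw [Set.indicator_of_mem h, abs_mul, abs_pow, abs_pow]
    have h1 := hx.abs_le i₁
    have h2 := hx.abs_le i
    calc |x i₁| ^ (N - 1) * |x i| ^ 2 ≤ C ^ (N - 1) * C ^ 2 := by gcongr
      _ = C ^ (N + 1) := by rw [← pow_add]; congr 1; omega
  · rw [Set.indicator_of_notMem h]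
    simp only [Set.mem_ofPred_eq, not_and_or, not_not] at h
    rcases h with h | h
    · rw [h, zero_pow (by omega)]; simp
    · simp [h]

/-- The sum is the mean support size on the event x_{i₁} ≠ 0, and a support has at most k elements.
No assumption on the correlations of D is needed. -/
lemma sum_measureReal_le (hV : IsValueDistribution V C) (hC : 0 ≤ C) (hD : IsSparse D k)
    (i₁ : Fin m) :
    ∑ i, (sparseLaw D V).real {x | x i₁ ≠ 0 ∧ x i ≠ 0} ≤ k * marginal D {i₁} := by
  have := hV.isProbabilityMeasure
  have hi : ∀ i, Integrable ({x : Fin m → ℝ | x i₁ ≠ 0 ∧ x i ≠ 0}.indicator fun _ => (1 : ℝ))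
      (sparseLaw D V) := fun i => (integrable_const _).indicator (measurableSet_ne_zero_and i₁ i)
  have h1 : ∑ i, (sparseLaw D V).real {x | x i₁ ≠ 0 ∧ x i ≠ 0}
      = ∫ x, ∑ i, {x : Fin m → ℝ | x i₁ ≠ 0 ∧ x i ≠ 0}.indicator (fun _ => (1 : ℝ)) x
        ∂sparseLaw D V := by
    rw [integral_finsetSum _ fun i _ => hi i]
    refine Finset.sum_congr rfl fun i _ => ?_
    rw [integral_indicator (measurableSet_ne_zero_and i₁ i), setIntegral_const]
    simp
  rw [h1, ← measureReal_ne_zero hV]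
  refine integral_le_of_ae_le_indicator (integrable_finsetSum _ fun i _ => hi i)
    (by simpa using measurableSet_forall_ne_zero {i₁}) ?_
  filter_upwards [ae_admissible hV hC hD] with x hx
  by_cases h : x i₁ = 0
  · simp [Set.indicator, h]
  · rw [Set.indicator_of_mem (show x ∈ {x : Fin m → ℝ | x i₁ ≠ 0} from h)]
    calc ∑ i, {x : Fin m → ℝ | x i₁ ≠ 0 ∧ x i ≠ 0}.indicator (fun _ => (1 : ℝ)) x
        = ∑ i, if x i ≠ 0 then 1 else 0 := by
          refine Finset.sum_congr rfl fun i _ => ?_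
          simp [Set.indicator, h]
      _ ≤ k := by
          rw [Finset.sum_boole]
          exact_mod_cast hx.card_le

lemma measureReal_and_le (hV : IsValueDistribution V C) (i₁ i : Fin m) :
    (sparseLaw D V).real {x | x i₁ ≠ 0 ∧ x i ≠ 0} ≤ marginal D {i₁} := by
  have := hV.isProbabilityMeasure
  rw [← measureReal_ne_zero hV]
  exact measureReal_mono fun x hx => hx.1

end LowOrder

/-! ### Quadratic forms in one seed -/

section QuadraticForm

variable {n m k : ℕ} {Q : Measure (Fin m → ℝ)} {i₁ : Fin m} {C ρ : ℝ}

/-- If the unordered pairs {l, l'} and {p, p'} differ, then l or l' occurs exactly once in the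
monomial. Its sign may be flipped, since neither of them is i₁. -/
lemma IsSeedLaw.integral_mul_mul_eq_zero (hQ : IsSeedLaw Q i₁ k C ρ) {l l' p p' : Fin m}
    (hl : l ≠ i₁) (hl' : l' ≠ i₁) (hll : l ≠ l') (hpp : p ≠ p')
    (h1 : ¬ (p = l ∧ p' = l')) (h2 : ¬ (p = l' ∧ p' = l)) :
    ∫ x, (x l * x l') * (x p * x p') ∂Q = 0 := by
  by_cases h : l = p ∨ l = p'
  · refine integral_eq_zero_of_flipAt (hQ.flip l' hl') fun x => ?_
    have hp : p ≠ l' := by rintro rfl; rcases h with rfl | rfl <;> simp_all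
    have hp' : p' ≠ l' := by rintro rfl; rcases h with rfl | rfl <;> simp_all
    rw [flipAt_self, flipAt_of_ne hll, flipAt_of_ne hp, flipAt_of_ne hp']
    ring
  · rw [not_or] at h
    refine integral_eq_zero_of_flipAt (hQ.flip l hl) fun x => ?_
    rw [flipAt_self, flipAt_of_ne hll.symm, flipAt_of_ne (Ne.symm h.1),
      flipAt_of_ne (Ne.symm h.2)]
    ring

/-- The second moment of a quadratic form without diagonal terms in the signs. -/
lemma IsSeedLaw.integral_offDiag_sq_le (hQ : IsSeedLaw Q i₁ k C ρ) {w : Fin m × Fin m → ℝ}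
    (hsymm : ∀ a, w a.swap = w a)
    (hw : ∀ a, w a ≠ 0 → a.1 ≠ i₁ ∧ a.2 ≠ i₁ ∧ a.1 ≠ a.2) :
    ∫ x, (∑ a, w a * (x a.1 * x a.2)) ^ 2 ∂Q ≤ 2 * (C ^ 4 * ρ ^ 2) * ∑ a, w a ^ 2 := by
  have h1 : ∀ x : Fin m → ℝ, (∑ a, w a * (x a.1 * x a.2)) ^ 2
      = ∑ a, ∑ b, (w a * w b) * ((x a.1 * x a.2) * (x b.1 * x b.2)) := by
    intro x
    rw [sq, Finset.sum_mul_sum]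
    exact Finset.sum_congr rfl fun _ _ => Finset.sum_congr rfl fun _ _ => by ring
  simp_rw [h1]
  rw [integral_finsetSum _ fun l _ => hQ.integrable (by fun_prop), Finset.mul_sum]
  refine Finset.sum_le_sum fun a _ => ?_
  rw [integral_finsetSum _ fun l _ => hQ.integrable (by fun_prop)]
  by_cases ha : w a = 0
  · simp [ha]
  obtain ⟨ha1, ha2, ha3⟩ := hw a ha
  have hne : a ≠ a.swap := fun h => ha3 (congrArg Prod.fst h)
  -- Each ordered pair correlates only with itself and its swap, whence the factor 2.
  rw [← Finset.sum_subset (Finset.subset_univ {a, a.swap}), Finset.sum_pair hne]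
  · rw [integral_const_mul, integral_const_mul, hsymm]
    have h2 : ∫ x, (x a.1 * x a.2) * (x a.1 * x a.2) ∂Q ≤ C ^ 4 * ρ ^ 2 := by
      refine le_trans (le_of_eq ?_) (hQ.integral_sq_mul_sq_le ha1 ha2 ha3)
      congr 1; funext x; ring
    have h3 : ∫ x, (x a.1 * x a.2) * (x a.swap.1 * x a.swap.2) ∂Q ≤ C ^ 4 * ρ ^ 2 := by
      refine le_trans (le_of_eq ?_) h2
      congr 1; funext x; simp only [Prod.fst_swap, Prod.snd_swap]; ring
    nlinarith [mul_le_mul_of_nonneg_left h2 (mul_self_nonneg (w a)),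
      mul_le_mul_of_nonneg_left h3 (mul_self_nonneg (w a))]
  · intro b _ hb
    rw [integral_const_mul]
    by_cases hwb : w b = 0
    · simp [hwb]
    rw [hQ.integral_mul_mul_eq_zero ha1 ha2 ha3 (hw b hwb).2.2, mul_zero]
    · rintro ⟨h, h'⟩
      exact hb (by simp [Prod.ext_iff, h, h'])
    · rintro ⟨h, h'⟩
      exact hb (by simp [Prod.ext_iff, h, h'])

/-- The matrix `G Θ² G` off the diagonal and off the index `i₁`. -/
def offDiag (A : Matrix (Fin n) (Fin m) ℝ) (i₁ : Fin m) (θ : Fin m → ℝ) (a : Fin m × Fin m) : ℝ :=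
  if a.1 ≠ i₁ ∧ a.2 ≠ i₁ ∧ a.1 ≠ a.2 then ∑ i, θ i ^ 2 * (gram A i a.1 * gram A i a.2) else 0

lemma offDiag_swap (A : Matrix (Fin n) (Fin m) ℝ) (i₁ : Fin m) (θ : Fin m → ℝ)
    (a : Fin m × Fin m) : offDiag A i₁ θ a.swap = offDiag A i₁ θ a := by
  have h : (a.2 ≠ i₁ ∧ a.1 ≠ i₁ ∧ a.2 ≠ a.1) ↔ (a.1 ≠ i₁ ∧ a.2 ≠ i₁ ∧ a.1 ≠ a.2) := by
    constructor <;> exact fun h => ⟨h.2.1, h.1, h.2.2.symm⟩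
  simp only [offDiag, Prod.fst_swap, Prod.snd_swap, h]
  simp_rw [mul_comm (gram A _ a.2)]

/-- This is the Frobenius norm of G Θ² G. One factor G, of operator norm at most σ², acts on the
columns of Θ² G; the other contributes through its row norms, at most σ⁴ when squared. Only ∑ θ⁴
remains. -/
lemma sum_offDiag_sq_le {A : Matrix (Fin n) (Fin m) ℝ} {σ : ℝ} (hσ : dictNorm A ≤ σ)
    (i₁ : Fin m) (θ : Fin m → ℝ) :
    ∑ a, offDiag A i₁ θ a ^ 2 ≤ σ ^ 8 * ∑ i, θ i ^ 4 := by
  calc ∑ a, offDiag A i₁ θ a ^ 2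
      ≤ ∑ a : Fin m × Fin m, (∑ i, gram A a.2 i * (θ i ^ 2 * gram A i a.1)) ^ 2 := by
        refine Finset.sum_le_sum fun a _ => ?_
        unfold offDiag
        split_ifs
        · refine le_of_eq ?_
          congr 1
          refine Finset.sum_congr rfl fun i _ => ?_
          rw [gram_comm A a.2]; ring
        · rw [zero_pow two_ne_zero]; positivity
    _ = ∑ l, ∑ l', (∑ i, gram A l' i * (θ i ^ 2 * gram A i l)) ^ 2 :=
        Fintype.sum_prod_type _
    _ ≤ ∑ l, σ ^ 4 * ∑ i, (θ i ^ 2 * gram A i l) ^ 2 :=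
        Finset.sum_le_sum fun l _ => sum_gram_mulVec_sq_le hσ fun i => θ i ^ 2 * gram A i l
    _ = σ ^ 4 * ∑ i, θ i ^ 4 * ∑ l, gram A l i ^ 2 := by
        rw [← Finset.mul_sum, Finset.sum_comm]
        congr 1
        refine Finset.sum_congr rfl fun i _ => ?_
        rw [Finset.mul_sum]
        refine Finset.sum_congr rfl fun l _ => ?_
        rw [gram_comm A i l]; ring
    _ ≤ σ ^ 4 * ∑ i, θ i ^ 4 * σ ^ 4 := by
        gcongr with i
        exact sum_gram_row_sq_le hσ i
    _ = _ := by rw [← Finset.sum_mul]; ring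

/-- The noise of one seed, weighted by `θ`: a part that is small for all seeds, a part controlled
by an `ℓ¹` norm, and a quadratic form without diagonal terms. -/
lemma Incoherent.sum_mul_noise_sq_le {A : Matrix (Fin n) (Fin m) ℝ} {μ : ℝ}
    (hA : Incoherent A μ) (hk : 1 ≤ k) (θ : Fin m → ℝ) {z : Fin m → ℝ} (hz : Admissible k C z) :
    ∑ i, (θ i * noise A i₁ z i) ^ 2 ≤ 4 * k * C ^ 2 * (μ ^ 2 / n) * ∑ i, θ i ^ 2
      + 2 * (∑ i, |θ i| * if i = i₁ then 0 else |z i|) ^ 2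
      + 2 * ∑ a, offDiag A i₁ θ a * (z a.1 * z a.2) := by
  set r := μ ^ 2 / (n : ℝ) with hr
  have hr0 : 0 ≤ r := by positivity
  set y : Fin m → ℝ := fun j => if j = i₁ then 0 else z j with hy
  set s := ∑ i, θ i ^ 2 with hs
  have hs0 : 0 ≤ s := Finset.sum_nonneg fun _ _ => sq_nonneg _
  have hzi : z i₁ ^ 2 ≤ C ^ 2 := by
    rw [← sq_abs]; have := hz.abs_le i₁; gcongr
  have hysum : ∑ l, y l ^ 2 ≤ k * C ^ 2 := by
    refine (Finset.sum_le_sum fun l _ => ?_).trans hz.sum_sq_le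
    simp only [hy]
    split_ifs
    · rw [zero_pow two_ne_zero]; positivity
    · exact le_rfl
  have hquad : ∑ i, θ i ^ 2 * (∑ j, gram A i j * y j) ^ 2
      = ∑ l, (∑ i, θ i ^ 2 * gram A i l ^ 2) * y l ^ 2
        + ∑ a, offDiag A i₁ θ a * (z a.1 * z a.2) := by
    have h1 : ∀ i, θ i ^ 2 * (∑ j, gram A i j * y j) ^ 2
        = ∑ a : Fin m × Fin m, θ i ^ 2 * (gram A i a.1 * gram A i a.2) * (y a.1 * y a.2) := by
      intro i
      rw [sq (∑ j, _), Finset.sum_mul_sum, Fintype.sum_prod_type, Finset.mul_sum]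
      refine Finset.sum_congr rfl fun l _ => ?_
      rw [Finset.mul_sum]
      exact Finset.sum_congr rfl fun l' _ => by ring
    simp_rw [h1]
    rw [Finset.sum_comm]
    have h2 : ∑ l, (∑ i, θ i ^ 2 * gram A i l ^ 2) * y l ^ 2 = ∑ a : Fin m × Fin m,
        if a.1 = a.2 then (∑ i, θ i ^ 2 * gram A i a.1 ^ 2) * y a.1 ^ 2 else 0 := by
      rw [Fintype.sum_prod_type]
      simp
    rw [h2, ← Finset.sum_add_distrib]
    refine Finset.sum_congr rfl fun a _ => ?_
    rw [← Finset.sum_mul]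
    unfold offDiag
    by_cases h12 : a.1 = a.2
    · rw [if_pos h12, if_neg (by tauto), ← h12]
      simp_rw [← sq]
      ring
    · rw [if_neg h12, zero_add]
      by_cases ha1 : a.1 = i₁
      · simp [hy, ha1]
      by_cases ha2 : a.2 = i₁
      · simp [hy, ha2]
      rw [if_pos ⟨ha1, ha2, h12⟩]
      simp [hy, ha1, ha2]
  -- The term i = l gives θ_l², and incoherence bounds the rest by r s. The resulting ∑ (θ_l y_l)²
  -- is at most the square of the ℓ¹ norm, so that Markov's inequality can later be applied before
  -- squaring.
  have hdiag : ∑ l, (∑ i, θ i ^ 2 * gram A i l ^ 2) * y l ^ 2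
      ≤ (∑ i, |θ i| * if i = i₁ then 0 else |z i|) ^ 2 + r * s * (k * C ^ 2) := by
    have h1 : ∀ l, ∑ i, θ i ^ 2 * gram A i l ^ 2 ≤ θ l ^ 2 + r * s := by
      intro l
      calc ∑ i, θ i ^ 2 * gram A i l ^ 2
          ≤ ∑ i, ((if i = l then θ i ^ 2 else 0) + r * θ i ^ 2) := by
            refine Finset.sum_le_sum fun i _ => ?_
            split_ifs with h
            · rw [h, hA.gram_self]
              have : 0 ≤ r * θ l ^ 2 := by positivity
              linarith
            · have h3 := hA.noiseCol_sq_le l i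
              rw [noiseCol, if_neg h] at h3
              rw [zero_add, mul_comm]
              gcongr
        _ = _ := by rw [Finset.sum_add_distrib, ← Finset.mul_sum]; simp [hs]
    calc ∑ l, (∑ i, θ i ^ 2 * gram A i l ^ 2) * y l ^ 2
        ≤ ∑ l, ((|θ l| * if l = i₁ then 0 else |z l|) ^ 2 + r * s * y l ^ 2) := by
          refine Finset.sum_le_sum fun l _ => ?_
          have h2 : (|θ l| * if l = i₁ then 0 else |z l|) ^ 2 = θ l ^ 2 * y l ^ 2 := by
            rw [mul_pow, sq_abs]; simp only [hy]; split_ifs <;> simp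
          rw [h2, ← add_mul]
          gcongr
          exact h1 l
      _ ≤ (∑ i, |θ i| * if i = i₁ then 0 else |z i|) ^ 2 + r * s * (k * C ^ 2) := by
          rw [Finset.sum_add_distrib, ← Finset.mul_sum]
          gcongr
          refine Finset.sum_sq_le_sq_sum_of_nonneg fun i _ => ?_
          split_ifs <;> positivity
  have hk1 : (1 : ℝ) ≤ k := by exact_mod_cast hk
  calc ∑ i, (θ i * noise A i₁ z i) ^ 2
      ≤ ∑ i, (2 * (C ^ 2 * r) * θ i ^ 2 + 2 * (θ i ^ 2 * (∑ j, gram A i j * y j) ^ 2)) := by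
        refine Finset.sum_le_sum fun i _ => ?_
        rw [hA.noise_eq, mul_pow]
        have h1 : (z i₁ * noiseCol A i₁ i) ^ 2 ≤ C ^ 2 * r := by
          rw [mul_pow]; gcongr; exact hA.noiseCol_sq_le i₁ i
        have h2 := add_sq_le (a := z i₁ * noiseCol A i₁ i) (b := ∑ j, gram A i j * y j)
        calc _ ≤ θ i ^ 2 * (2 * (C ^ 2 * r + (∑ j, gram A i j * y j) ^ 2)) := by
              gcongr; exact h2.trans (by gcongr)
          _ = _ := by ring
    _ = 2 * (C ^ 2 * r) * s + 2 * ∑ i, θ i ^ 2 * (∑ j, gram A i j * y j) ^ 2 := by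
        rw [Finset.sum_add_distrib, ← Finset.mul_sum, ← Finset.mul_sum]
    _ ≤ _ := by
        rw [hquad]
        have h3 : 2 * (C ^ 2 * r) * s ≤ 2 * (C ^ 2 * r) * s * k :=
          le_mul_of_one_le_right (by positivity) hk1
        linarith

end QuadraticForm

/-! ### Markov's inequality for finitely many variables -/

lemma le_measure_of_markov {Ω ι : Type*} [MeasurableSpace Ω] {ν : Measure Ω}
    [IsProbabilityMeasure ν] [Fintype ι] {f : ι → Ω → ℝ} (hf : ∀ i, Integrable (f i) ν)
    (hf0 : ∀ i ω, 0 ≤ f i ω) {E : ι → ℝ} (hE : ∀ i, 0 < E i) (hfE : ∀ i, ∫ ω, f i ω ∂ν ≤ E i)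
    {δ S : ℝ} (hδ : 0 ≤ δ) (hS : 0 < S) (hcard : Fintype.card ι ≤ δ * S) {s : Set Ω}
    (h : ∀ᵐ ω ∂ν, (∀ i, f i ω ≤ S * E i) → ω ∈ s) : ENNReal.ofReal (1 - δ) ≤ ν s := by
  have h1 : ∀ i, ν {ω | S * E i ≤ f i ω} ≤ ENNReal.ofReal (1 / S) := by
    intro i
    have h2 := mul_meas_ge_le_integral_of_nonneg (Filter.Eventually.of_forall (hf0 i)) (hf i)
      (S * E i)
    have h3 : ν.real {ω | S * E i ≤ f i ω} ≤ 1 / S := by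
      rw [le_div_iff₀ hS]
      have h4 : S * E i * ν.real {ω | S * E i ≤ f i ω} ≤ E i := h2.trans (hfE i)
      have : E i * (ν.real {ω | S * E i ≤ f i ω} * S) ≤ E i * 1 := by linarith
      exact le_of_mul_le_mul_left this (hE i)
    rw [← ofReal_measureReal]
    exact ENNReal.ofReal_le_ofReal h3
  have h2 : ν sᶜ ≤ ENNReal.ofReal δ := by
    calc ν sᶜ ≤ ν (⋃ i, {ω | S * E i ≤ f i ω}) := by
          refine measure_mono_ae ?_
          filter_upwards [h] with ω hω hs
          by_contra hne
          refine hs (hω fun i => ?_)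
          by_contra hi
          exact hne (Set.mem_iUnion.2 ⟨i, (not_le.1 hi).le⟩)
      _ ≤ ∑ i, ν {ω | S * E i ≤ f i ω} := measure_iUnion_fintype_le _ _
      _ ≤ ∑ _i : ι, ENNReal.ofReal (1 / S) := Finset.sum_le_sum fun i _ => h1 i
      _ = ENNReal.ofReal (Fintype.card ι * (1 / S)) := by
          rw [Finset.sum_const, nsmul_eq_mul, Finset.card_univ,
            ENNReal.ofReal_mul (Nat.cast_nonneg _), ENNReal.ofReal_natCast]
      _ ≤ ENNReal.ofReal δ := by
          refine ENNReal.ofReal_le_ofReal ?_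
          rw [mul_one_div, div_le_iff₀ hS]
          exact hcard
  calc ENNReal.ofReal (1 - δ) = 1 - ENNReal.ofReal δ := by
        rw [ENNReal.ofReal_sub _ hδ, ENNReal.ofReal_one]
    _ ≤ ν Set.univ - ν sᶜ := by rw [measure_univ]; exact tsub_le_tsub_left h2 _
    _ ≤ ν s := by
        rw [tsub_le_iff_right, ← Set.union_compl_self s]
        exact measure_union_le _ _

/-! ### Consequences of the sparsity condition -/

/-- The relations between the parameters that the estimates use. Here `b` is the loss
`W ^ (2 L) (log m) ^ max 0 (c - 4 L)` with `W = C (σ² + μ √(m / n)) log² (n m)`, `l` is `log m`,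
and `e` is `(log m) ^ c`. -/
structure ParameterBounds (n m k μ σ τ W b l e K : ℝ) : Prop where
  one_le_n : 1 ≤ n
  n_le_m : n ≤ m
  one_le_k : 1 ≤ k
  one_le_mu : 1 ≤ μ
  one_le_sigma : 1 ≤ σ
  one_le_tau : 1 ≤ τ
  one_le_l : 1 ≤ l
  one_le_e : 1 ≤ e
  one_le_K : 1 ≤ K
  sparsity : k * τ * μ ^ 2 * b ≤ √n
  m_le : m ≤ n * W ^ 2
  sigma_sq_le : σ ^ 2 ≤ W
  l_sq_le : l ^ 2 ≤ W
  W_pow_le : W ^ 16 ≤ b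
  sigma_pow_mul_le : σ ^ 32 * e ≤ b
  l_sq_mul_le : l ^ 2 * e ≤ K * √n

namespace ParameterBounds

variable {n m k μ σ τ W b l e K : ℝ}

lemma one_le_W (h : ParameterBounds n m k μ σ τ W b l e K) : 1 ≤ W :=
  (one_le_pow₀ h.one_le_sigma).trans h.sigma_sq_le

lemma W_pow_le_of_le (h : ParameterBounds n m k μ σ τ W b l e K) {j : ℕ} (hj : j ≤ 16) :
    W ^ j ≤ b :=
  (pow_le_pow_right₀ h.one_le_W hj).trans h.W_pow_le

lemma one_le_b (h : ParameterBounds n m k μ σ τ W b l e K) : 1 ≤ b :=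
  (one_le_pow₀ h.one_le_W).trans h.W_pow_le

lemma sigma_pow_le (h : ParameterBounds n m k μ σ τ W b l e K) {j : ℕ} (hj : j ≤ 32) :
    σ ^ j * e ≤ b :=
  (mul_le_mul_of_nonneg_right (pow_le_pow_right₀ h.one_le_sigma hj)
    (zero_le_one.trans h.one_le_e)).trans h.sigma_pow_mul_le

lemma e_le (h : ParameterBounds n m k μ σ τ W b l e K) : e ≤ b := by
  simpa using h.sigma_pow_le (j := 0) (by norm_num)

lemma sq_sqrt (h : ParameterBounds n m k μ σ τ W b l e K) : √n ^ 2 = n :=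
  Real.sq_sqrt (zero_le_one.trans h.one_le_n)

/-- `kτμ²` bounds the products of at most as many factors. -/
lemma prod_le (h : ParameterBounds n m k μ σ τ W b l e K) {i₁ i₂ i₃ j : ℕ} (h1 : i₁ ≤ j)
    (h2 : i₂ ≤ j) (h3 : i₃ ≤ 2 * j) : k ^ i₁ * τ ^ i₂ * μ ^ i₃ ≤ (k * τ * μ ^ 2) ^ j := by
  have hk := h.one_le_k
  have hτ := h.one_le_tau
  have hμ := h.one_le_mu
  rw [mul_pow, mul_pow, ← pow_mul]
  gcongr

/-- A monomial with at most `j` powers of `b` is dominated by `√n ^ j`. -/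
lemma mul_pow_le (h : ParameterBounds n m k μ σ τ W b l e K) {i₁ i₂ i₃ j : ℕ} (h1 : i₁ ≤ j)
    (h2 : i₂ ≤ j) (h3 : i₃ ≤ 2 * j) {x : ℝ} (hx : x ≤ b ^ j) :
    k ^ i₁ * τ ^ i₂ * μ ^ i₃ * x ≤ √n ^ j := by
  have hk := h.one_le_k
  have hτ := h.one_le_tau
  have hμ := h.one_le_mu
  have hb := h.one_le_b
  calc k ^ i₁ * τ ^ i₂ * μ ^ i₃ * x ≤ k ^ i₁ * τ ^ i₂ * μ ^ i₃ * b ^ j := by gcongr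
    _ ≤ (k * τ * μ ^ 2) ^ j * b ^ j := by gcongr ?_ * _; exact h.prod_le h1 h2 h3
    _ = (k * τ * μ ^ 2 * b) ^ j := by rw [mul_pow _ b]
    _ ≤ √n ^ j := by gcongr; exact h.sparsity

/-- For the part that is small for every seed: no Markov loss `l ^ 2` occurs. -/
lemma incoherence_term_le (h : ParameterBounds n m k μ σ τ W b l e K) :
    σ ^ 2 * e ^ 2 * (k ^ 2 * (μ ^ 2 / n)) ≤ 1 := by
  have hn : 0 < n := zero_lt_one.trans_le h.one_le_n
  have he := h.one_le_e
  have hσ := h.one_le_sigma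
  have h1 := h.mul_pow_le (i₁ := 2) (i₂ := 0) (i₃ := 2) (j := 2) (x := (σ ^ 1 * e) ^ 2) le_rfl
    (by norm_num) (by norm_num) (by gcongr; exact h.sigma_pow_le (by norm_num))
  rw [h.sq_sqrt] at h1
  rw [← mul_div_assoc, ← mul_div_assoc, div_le_one hn]
  calc _ = _ := by ring
    _ ≤ n := h1

/-- For the ℓ¹ part before squaring: a single σ e stands next to the Markov loss `l ^ 2`, and each
of the two is at most b. -/
lemma collision_term_le (h : ParameterBounds n m k μ σ τ W b l e K) :
    σ * e * (l ^ 2 * (τ * (k / m) * k)) ≤ 1 := by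
  have hn : 0 < n := zero_lt_one.trans_le h.one_le_n
  have hm : 0 < m := hn.trans_le h.n_le_m
  have he := h.one_le_e
  have hσ := h.one_le_sigma
  have hl := h.one_le_l
  have hb := h.one_le_b
  have h1 := h.mul_pow_le (i₁ := 2) (i₂ := 1) (i₃ := 0) (j := 2) (x := (σ ^ 1 * e) * l ^ 2) le_rfl
    (by norm_num) (by norm_num) (by
      rw [sq b]
      refine mul_le_mul (h.sigma_pow_le (by norm_num)) ?_ (by positivity) (by positivity)
      exact h.l_sq_le.trans (by simpa using h.W_pow_le_of_le (j := 1) (by norm_num)))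
  rw [h.sq_sqrt] at h1
  have : σ * e * (l ^ 2 * (τ * (k / m) * k))
      = (k ^ 2 * τ ^ 1 * μ ^ 0 * ((σ ^ 1 * e) * l ^ 2)) / m := by
    field_simp
  rw [this, div_le_one hm]
  exact h1.trans h.n_le_m

/-- Only b³ is available against e⁴. The denominator leaves a spare √n, which absorbs the last e
together with `l ^ 2`; this is where K enters. -/
lemma offDiag_term_le (h : ParameterBounds n m k μ σ τ W b l e K) :
    σ ^ 12 * e ^ 4 * l ^ 2 * ((τ * (k / m)) ^ 2 * k) ≤ K := by
  have hn : 0 < n := zero_lt_one.trans_le h.one_le_n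
  have hm : 0 < m := hn.trans_le h.n_le_m
  have he := h.one_le_e
  have hσ := h.one_le_sigma
  have hl := h.one_le_l
  have hb := h.one_le_b
  have hk := h.one_le_k
  have hτ := h.one_le_tau
  have hK := h.one_le_K
  have h1 := h.mul_pow_le (i₁ := 3) (i₂ := 2) (i₃ := 0) (j := 3) (x := (σ ^ 4 * e) ^ 3) le_rfl
    (by norm_num) (by norm_num) (by gcongr; exact h.sigma_pow_le (by norm_num))
  have : σ ^ 12 * e ^ 4 * l ^ 2 * ((τ * (k / m)) ^ 2 * k)
      = (k ^ 3 * τ ^ 2 * μ ^ 0 * (σ ^ 4 * e) ^ 3 * (l ^ 2 * e)) / m ^ 2 := by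
    field_simp
  rw [this, div_le_iff₀ (by positivity)]
  have hnm : n ^ 2 ≤ m ^ 2 := by gcongr; exact h.n_le_m
  calc k ^ 3 * τ ^ 2 * μ ^ 0 * (σ ^ 4 * e) ^ 3 * (l ^ 2 * e)
      ≤ √n ^ 3 * (K * √n) := mul_le_mul h1 h.l_sq_mul_le (by positivity) (by positivity)
    _ = K * (√n ^ 2) ^ 2 := by ring
    _ ≤ K * m ^ 2 := by rw [h.sq_sqrt]; gcongr

/-- The square of the size of the bilinear form that controls the higher order terms. -/
lemma higher_sq_le (h : ParameterBounds n m k μ σ τ W b l e K) :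
    k ^ 3 * τ ^ 2 * μ ^ 4 * σ ^ 8 / n ^ 2 ≤ 1 := by
  have hn : 0 < n := zero_lt_one.trans_le h.one_le_n
  have hb := h.one_le_b
  have h1 := h.mul_pow_le (i₁ := 3) (i₂ := 2) (i₃ := 4) (j := 4) (x := σ ^ 8) (by norm_num)
    (by norm_num) (by norm_num) (by
      calc σ ^ 8 = (σ ^ 2) ^ 4 := by ring
        _ ≤ b ^ 4 := by
          gcongr
          exact h.sigma_sq_le.trans (by simpa using h.W_pow_le_of_le (j := 1) (by norm_num)))
  rw [div_le_one (by positivity)]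
  calc _ ≤ _ := h1
    _ = (√n ^ 2) ^ 2 := by ring
    _ = n ^ 2 := by rw [h.sq_sqrt]

/-- For the sets T with at least two elements that omit some factor. -/
lemma pair_term_le (h : ParameterBounds n m k μ σ τ W b l e K) :
    σ ^ 2 * e ^ 2 * l ^ 2 * (k * (k ^ 3 * τ ^ 2 * μ ^ 4 * σ ^ 8 / n ^ 2)) ≤ 1 := by
  have hn : 0 < n := zero_lt_one.trans_le h.one_le_n
  have hb := h.one_le_b
  have he := h.one_le_e
  have hσ := h.one_le_sigma
  have hl := h.one_le_l
  have hW := h.one_le_W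
  have h1 := h.mul_pow_le (i₁ := 4) (i₂ := 2) (i₃ := 4) (j := 4)
    (x := e ^ 2 * ((σ ^ 2) ^ 5 * l ^ 2)) le_rfl (by norm_num) (by norm_num) (by
      calc e ^ 2 * ((σ ^ 2) ^ 5 * l ^ 2) ≤ b ^ 2 * (W ^ 5 * W) := by
            gcongr
            · exact h.e_le
            · exact h.sigma_sq_le
            · exact h.l_sq_le
        _ = b ^ 2 * W ^ 6 := by ring
        _ ≤ b ^ 2 * b := by gcongr; exact h.W_pow_le_of_le (by norm_num)
        _ = b ^ 3 := by ring
        _ ≤ b ^ 4 := pow_le_pow_right₀ hb (by norm_num))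
  have : σ ^ 2 * e ^ 2 * l ^ 2 * (k * (k ^ 3 * τ ^ 2 * μ ^ 4 * σ ^ 8 / n ^ 2))
      = (k ^ 4 * τ ^ 2 * μ ^ 4 * (e ^ 2 * ((σ ^ 2) ^ 5 * l ^ 2))) / n ^ 2 := by
    field_simp
  rw [this, div_le_one (by positivity)]
  calc _ ≤ _ := h1
    _ = (√n ^ 2) ^ 2 := by ring
    _ = n ^ 2 := by rw [h.sq_sqrt]

/-- For T the set of all factors. The sum over all m coordinates is paid for by m ≤ n W² and the
second power of γ. -/
lemma full_term_le (h : ParameterBounds n m k μ σ τ W b l e K) :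
    σ ^ 2 * e ^ 2 * l ^ 2 * (m * l ^ 2 * (k ^ 3 * τ ^ 2 * μ ^ 4 * σ ^ 8 / n ^ 2) ^ 2) ≤ 1 := by
  have hn : 0 < n := zero_lt_one.trans_le h.one_le_n
  have hb := h.one_le_b
  have he := h.one_le_e
  have hσ := h.one_le_sigma
  have hl := h.one_le_l
  have hW := h.one_le_W
  have hk := h.one_le_k
  have hτ := h.one_le_tau
  have hμ := h.one_le_mu
  have h1 := h.mul_pow_le (i₁ := 6) (i₂ := 4) (i₃ := 8) (j := 6)
    (x := e ^ 2 * ((σ ^ 2) ^ 9 * (l ^ 2) ^ 2 * W ^ 2)) le_rfl (by norm_num) (by norm_num) (by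
      calc e ^ 2 * ((σ ^ 2) ^ 9 * (l ^ 2) ^ 2 * W ^ 2) ≤ b ^ 2 * (W ^ 9 * W ^ 2 * W ^ 2) := by
            gcongr
            · exact h.e_le
            · exact h.sigma_sq_le
            · exact h.l_sq_le
        _ = b ^ 2 * W ^ 13 := by ring
        _ ≤ b ^ 2 * b := by gcongr; exact h.W_pow_le_of_le (by norm_num)
        _ = b ^ 3 := by ring
        _ ≤ b ^ 6 := pow_le_pow_right₀ hb (by norm_num))
  calc σ ^ 2 * e ^ 2 * l ^ 2 * (m * l ^ 2 * (k ^ 3 * τ ^ 2 * μ ^ 4 * σ ^ 8 / n ^ 2) ^ 2)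
      ≤ σ ^ 2 * e ^ 2 * l ^ 2 * ((n * W ^ 2) * l ^ 2 *
          (k ^ 3 * τ ^ 2 * μ ^ 4 * σ ^ 8 / n ^ 2) ^ 2) := by gcongr; exact h.m_le
    _ = (k ^ 6 * τ ^ 4 * μ ^ 8 * (e ^ 2 * ((σ ^ 2) ^ 9 * (l ^ 2) ^ 2 * W ^ 2))) / n ^ 3 := by
        field_simp
    _ ≤ 1 := by
        rw [div_le_one (by positivity)]
        calc _ ≤ _ := h1
          _ = (√n ^ 2) ^ 3 := by ring
          _ = n ^ 3 := by rw [h.sq_sqrt]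

end ParameterBounds

/-- The sparsity condition of the theorem, unfolded. -/
lemma parameterBounds {n m k L : ℕ} {c C μ σ τ : ℝ} (hc : 2 ≤ c) (hL : 8 ≤ L) (hC : 1 ≤ C)
    (hn : 1 ≤ n) (hnm : n ≤ m) (hk : 1 ≤ k) (hμ : 1 ≤ μ) (hσ : 1 ≤ σ) (hτ : 1 ≤ τ)
    (hl : 1 ≤ Real.log m)
    (hkn : (k : ℝ) ≤ √(n : ℝ) / (nu 1 C σ μ n m (1 / (m : ℝ)) (2 * L) * τ * μ ^ 2 *
      Real.log m ^ max 0 (c - 4 * L))) :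
    ∃ W b : ℝ, ParameterBounds n m k μ σ τ W b (Real.log m) (Real.log m ^ c)
      ((4 * (c + 2)) ^ (c + 2)) := by
  set l := Real.log m with hl_def
  have hn' : (1 : ℝ) ≤ n := by exact_mod_cast hn
  have hnm' : (n : ℝ) ≤ m := by exact_mod_cast hnm
  have hm' : (1 : ℝ) ≤ m := hn'.trans hnm'
  have hk' : (1 : ℝ) ≤ k := by exact_mod_cast hk
  have hn0 : (0 : ℝ) < n := by linarith
  have hm0 : (0 : ℝ) < m := by linarith
  set W := C * (σ ^ 2 + μ * √((m : ℝ) / n)) * Real.log (n / (1 / (m : ℝ))) ^ 2 with hW_def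
  set Λ := l ^ max 0 (c - 4 * L) with hΛ_def
  set b := W ^ (2 * L) * Λ with hb_def
  have hΛ : 1 ≤ Λ := Real.one_le_rpow hl (le_max_left _ _)
  have hlog : l ≤ Real.log (n / (1 / (m : ℝ))) := by
    rw [hl_def, one_div, div_inv_eq_mul]
    exact Real.log_le_log hm0 (le_mul_of_one_le_left hm0.le hn')
  have hs0 : 0 ≤ √((m : ℝ) / n) := Real.sqrt_nonneg _
  have hbase : σ ^ 2 + √((m : ℝ) / n) ≤ C * (σ ^ 2 + μ * √((m : ℝ) / n)) := by
    calc σ ^ 2 + √((m : ℝ) / n) ≤ σ ^ 2 + μ * √((m : ℝ) / n) := by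
          gcongr; exact le_mul_of_one_le_left hs0 hμ
      _ ≤ _ := le_mul_of_one_le_left (by positivity) hC
  have hW1 : (σ ^ 2 + √((m : ℝ) / n)) * l ^ 2 ≤ W := by
    rw [hW_def]; gcongr
  have hl2 : 1 ≤ l ^ 2 := one_le_pow₀ hl
  have hσ2 : 1 ≤ σ ^ 2 := one_le_pow₀ hσ
  have hWσl : σ ^ 2 * l ^ 2 ≤ W :=
    le_trans (by gcongr; exact le_add_of_nonneg_right hs0) hW1
  have hWσ : σ ^ 2 ≤ W := (le_mul_of_one_le_right (by positivity) hl2).trans hWσl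
  have hWl : l ^ 2 ≤ W := (le_mul_of_one_le_left (by positivity) hσ2).trans hWσl
  have hW : 1 ≤ W := hl2.trans hWl
  have hWs : √((m : ℝ) / n) ≤ W := by
    refine le_trans ?_ hW1
    calc √((m : ℝ) / n) ≤ σ ^ 2 + √((m : ℝ) / n) := le_add_of_nonneg_left (by positivity)
      _ ≤ _ := le_mul_of_one_le_right (by positivity) hl2
  have hW16 : W ^ 16 ≤ b := by
    calc W ^ 16 ≤ W ^ (2 * L) := pow_le_pow_right₀ hW (by omega)
      _ ≤ b := le_mul_of_one_le_right (by positivity) hΛ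
  have hsp : k * τ * μ ^ 2 * b ≤ √(n : ℝ) := by
    have hden : 0 < nu 1 C σ μ n m (1 / (m : ℝ)) (2 * L) * τ * μ ^ 2 * Λ := by
      rw [nu, ← hW_def]; positivity
    rw [le_div_iff₀ hden, nu, ← hW_def] at hkn
    calc k * τ * μ ^ 2 * b = k * (1 * W ^ (2 * L) * τ * μ ^ 2 * Λ) := by rw [hb_def]; ring
      _ ≤ _ := hkn
  have hmW : (m : ℝ) ≤ n * W ^ 2 := by
    have : (m : ℝ) / n ≤ W ^ 2 := by
      rw [← Real.sq_sqrt (show (0 : ℝ) ≤ m / n by positivity)]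
      gcongr
    rw [div_le_iff₀ hn0] at this
    linarith
  have hb1 : 1 ≤ b := (one_le_pow₀ hW).trans hW16
  refine ⟨W, b, hn', hnm', hk', hμ, hσ, hτ, hl, Real.one_le_rpow hl (by linarith), ?_, hsp, hmW,
    hWσ, hWl, hW16, ?_, ?_⟩
  · exact Real.one_le_rpow (by linarith) (by linarith)
  -- W ≥ σ² l² supplies l^(4L) through W^(2L); the maximum in the hypothesis makes up for what is
  -- missing to l^c.
  · have h1 : l ^ c ≤ l ^ (4 * L) * Λ := by
      rw [hΛ_def, ← Real.rpow_natCast, ← Real.rpow_add (by linarith)]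
      refine Real.rpow_le_rpow_of_exponent_le hl ?_
      push_cast
      linarith [le_max_right 0 (c - 4 * L)]
    calc σ ^ 32 * l ^ c ≤ σ ^ (4 * L) * (l ^ (4 * L) * Λ) := by
          gcongr
          omega
      _ = (σ ^ 2 * l ^ 2) ^ (2 * L) * Λ := by rw [mul_pow, ← pow_mul, ← pow_mul]; ring_nf
      _ ≤ b := by rw [hb_def]; gcongr
  · have hc2 : 0 < c + 2 := by linarith
    -- The sparsity condition bounds b, hence W², by √n, and m/n ≤ W². Thus m is at most polynomial
    -- in n, so powers of log m are negligible against √n.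
    have hmn : (m : ℝ) ≤ n ^ 2 := by
      have hbn : b ≤ √(n : ℝ) := by
        refine le_trans (le_mul_of_one_le_left (by linarith) ?_) hsp
        exact one_le_mul_of_one_le_of_one_le (one_le_mul_of_one_le_of_one_le hk' hτ)
          (one_le_pow₀ hμ)
      have hWb : W ^ 2 ≤ b := (pow_le_pow_right₀ hW (by norm_num)).trans hW16
      have hsn : √(n : ℝ) ≤ n := by
        rw [Real.sqrt_le_left hn0.le]; nlinarith
      calc (m : ℝ) ≤ n * W ^ 2 := hmW
        _ ≤ n * n := by gcongr; exact hWb.trans (hbn.trans hsn)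
        _ = n ^ 2 := by ring
    -- This exponent makes the power c + 2 equal to m^(1/4) ≤ √n, up to the constant.
    have hlm : l ≤ m ^ (1 / (4 * (c + 2))) * (4 * (c + 2)) := by
      have := Real.log_le_rpow_div hm0.le (show 0 < 1 / (4 * (c + 2)) by positivity)
      rwa [div_div_eq_mul_div, div_one] at this
    calc l ^ 2 * l ^ c = l ^ (c + 2) := by
          rw [Real.rpow_add (by linarith), mul_comm]; norm_num
      _ ≤ (m ^ (1 / (4 * (c + 2))) * (4 * (c + 2))) ^ (c + 2) := by gcongr
      _ = (4 * (c + 2)) ^ (c + 2) * (m : ℝ) ^ (1 / 4 : ℝ) := by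
          rw [Real.mul_rpow (by positivity) (by positivity), ← Real.rpow_mul hm0.le, mul_comm]
          congr 2
          field_simp
      _ ≤ (4 * (c + 2)) ^ (c + 2) * √(n : ℝ) := by
          gcongr
          calc (m : ℝ) ^ (1 / 4 : ℝ) ≤ ((n : ℝ) ^ 2) ^ (1 / 4 : ℝ) := by gcongr
            _ = √(n : ℝ) := by
              rw [← Real.rpow_natCast, ← Real.rpow_mul hn0.le, Real.sqrt_eq_rpow]
              norm_num

/-! ### The error terms -/

section Assembly

variable {n m k N : ℕ} {A : Matrix (Fin n) (Fin m) ℝ} {V : Measure ℝ} {C : ℝ}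
  {D : PMF (Finset (Fin m))} {i₁ : Fin m}

lemma Admissible.abs_sum_mul_le {x y : Fin m → ℝ} (hy : Admissible k C y)
    (hx : Admissible k C x) : |∑ i, y i * x i| ≤ k * C ^ 2 := by
  refine abs_le_of_sq_le_sq ?_ (by positivity)
  calc (∑ i, y i * x i) ^ 2 ≤ (∑ i, y i ^ 2) * ∑ i, x i ^ 2 :=
        Finset.sum_mul_sq_le_sq_mul_sq _ _ _
    _ ≤ (k * C ^ 2) * (k * C ^ 2) :=
        mul_le_mul hy.sum_sq_le hx.sum_sq_le (Finset.sum_nonneg fun _ _ => sq_nonneg _)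
          (by positivity)
    _ = _ := by ring

/-- A surviving power of y_{i₁} x_{i₁} forces both supports to contain i₁. All the weight can
therefore sit on that coordinate, at the price of k from Cauchy–Schwarz. -/
lemma Admissible.abs_pow_mul_sum_le (hC : 0 ≤ C) {x y : Fin m → ℝ} (hy : Admissible k C y)
    (hx : Admissible k C x) {a : ℕ} (ha : a ≠ 0) :
    |(y i₁ * x i₁) ^ a * ∑ i, y i * x i|
      ≤ ∑ i, if y i ≠ 0 ∧ x i ≠ 0 then (if i = i₁ then C ^ (2 * a) * (k * C ^ 2) else 0)
        else 0 := by
  have h1 : ∑ i, (if y i ≠ 0 ∧ x i ≠ 0 then (if i = i₁ then C ^ (2 * a) * (k * C ^ 2) else 0)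
        else 0) = if y i₁ ≠ 0 ∧ x i₁ ≠ 0 then C ^ (2 * a) * (k * C ^ 2) else 0 := by
    rw [Finset.sum_eq_single i₁]
    · simp
    · intro i _ hi
      simp [hi]
    · simp
  rw [h1]
  split_ifs with h
  · rw [abs_mul, abs_pow, abs_mul, pow_mul, sq C]
    have := hy.abs_le i₁
    have := hx.abs_le i₁
    have h2 := hy.abs_sum_mul_le hx
    rw [sq] at h2
    gcongr
  · have : y i₁ * x i₁ = 0 := by
      rw [mul_eq_zero]; tauto
    rw [this, zero_pow ha, zero_mul, abs_zero]

/-- Used when no factor x_{i₁} is left: the supports may then meet anywhere. -/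
lemma Admissible.abs_sum_mul_le_sum {x y : Fin m → ℝ} (hy : Admissible k C y)
    (hx : Admissible k C x) :
    |∑ i, y i * x i| ≤ ∑ i, if y i ≠ 0 ∧ x i ≠ 0 then C ^ 2 else 0 := by
  refine (Finset.abs_sum_le_sum_abs _ _).trans (Finset.sum_le_sum fun i _ => ?_)
  split_ifs with h
  · rw [abs_mul, sq]
    have h1 := hy.abs_le i
    have h2 := hx.abs_le i
    have := (abs_nonneg _).trans h1
    gcongr
  · have : y i * x i = 0 := by
      rw [mul_eq_zero]; tauto
    rw [this, abs_zero]

/-- The constant in the second moments of the terms with several noise factors. -/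
def momentConst (N : ℕ) (C : ℝ) : ℝ :=
  C ^ (2 * N + 2) * (N.factorial * (2 * Real.exp (1 / 2)) * (2 * C ^ 4) ^ N)

lemma momentConst_pos (N : ℕ) (hC : 0 < C) : 0 < momentConst N C := by
  unfold momentConst
  have := N.factorial_pos
  positivity

/-- The second moments of the terms with at least two noise factors. -/
lemma integral_sum_noiseMoment_sq_le_momentConst {μ σ τ W b l e K : ℝ} (hA : Incoherent A μ)
    (hσ : dictNorm A ≤ σ) (hV : IsValueDistribution V C) (hC : 1 ≤ C) (hD : IsSparse D k)
    (hq : ∀ i, marginal D {i} ≤ marginal D {i₁} * l)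
    (hp : ParameterBounds n m k μ σ τ W b l e K)
    {Q : Measure (Fin m → ℝ)} (hQ : IsSeedLaw Q i₁ k C (τ * (k / m))) (hN : 4 ≤ N)
    (T : Finset (Fin N)) (hT : 2 ≤ T.card) :
    Integrable (fun ζ => ∑ i, noiseMoment A (sparseLaw D V) i₁ T ζ i ^ 2)
      (Measure.pi fun _ : Fin N => Q) ∧
    ∫ ζ, ∑ i, noiseMoment A (sparseLaw D V) i₁ T ζ i ^ 2 ∂Measure.pi (fun _ : Fin N => Q)
      ≤ momentConst N C * marginal D {i₁} ^ 2 *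
        (k * (k ^ 3 * τ ^ 2 * μ ^ 4 * σ ^ 8 / n ^ 2)
          + m * l ^ 2 * (k ^ 3 * τ ^ 2 * μ ^ 4 * σ ^ 8 / n ^ 2) ^ 2) := by
  set γ : ℝ := k ^ 3 * τ ^ 2 * μ ^ 4 * σ ^ 8 / n ^ 2 with hγ_def
  set q := marginal D {i₁} with hq_def
  have hq0 : 0 ≤ q := marginal_nonneg D _
  have hn := hp.one_le_n
  have hk := hp.one_le_k
  have hμ := hp.one_le_mu
  have hσ1 := hp.one_le_sigma
  have hτ := hp.one_le_tau
  have hl := hp.one_le_l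
  have hnm := hp.n_le_m
  have hγ0 : 0 < γ := by positivity
  have hγ1 : γ ≤ 1 := hp.higher_sq_le
  have hs1 : √γ ≤ 1 := Real.sqrt_le_one.2 hγ1
  have hs2 : √γ ^ 2 = γ := Real.sq_sqrt hγ0.le
  have hs4 : √γ ^ 4 = γ ^ 2 := by rw [show √γ ^ 4 = (√γ ^ 2) ^ 2 by ring, hs2]
  have hb : 0 < 2 * C ^ 3 * √γ := by positivity
  have hb2 : 2 * C ^ 6 * (k * (μ ^ 2 / n)) ^ 2 * k + 2 * C ^ 6 * (τ * (k / m)) ^ 2 * σ ^ 8 * k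
      ≤ (2 * C ^ 3 * √γ) ^ 2 := by
    have h1 : (k * (μ ^ 2 / n)) ^ 2 * k ≤ γ := by
      have : ((k : ℝ) * (μ ^ 2 / n)) ^ 2 * k = k ^ 3 * 1 * μ ^ 4 * 1 / n ^ 2 := by field_simp
      rw [this, hγ_def]
      gcongr
      · exact one_le_pow₀ hτ
      · exact one_le_pow₀ hσ1
    have h2 : (τ * (k / m)) ^ 2 * σ ^ 8 * k ≤ γ := by
      have : (τ * ((k : ℝ) / m)) ^ 2 * σ ^ 8 * k = k ^ 3 * τ ^ 2 * 1 * σ ^ 8 / m ^ 2 := by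
        field_simp
      rw [this, hγ_def]
      gcongr
      exact one_le_pow₀ hμ
    calc _ = 2 * C ^ 6 * ((k * (μ ^ 2 / n)) ^ 2 * k)
          + 2 * C ^ 6 * ((τ * (k / m)) ^ 2 * σ ^ 8 * k) := by ring
      _ ≤ 2 * C ^ 6 * γ + 2 * C ^ 6 * γ := by gcongr
      _ = (2 * C ^ 3) ^ 2 * √γ ^ 2 := by rw [hs2]; ring
      _ = _ := by ring
  have hTN : T.card ≤ N := by simpa using Finset.card_le_univ T
  have hCb : (C * (2 * C ^ 3 * √γ)) ^ T.card = (2 * C ^ 4) ^ T.card * √γ ^ T.card := by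
    rw [← mul_pow]; ring_nf
  have hC4 : 1 ≤ 2 * C ^ 4 := by have := one_le_pow₀ hC (n := 4); linarith
  -- Since √γ ≤ 1, surplus noise factors can be dropped. The exponent kept is 4 when T is everything
  -- and 2 otherwise.
  have hbound : ∀ j, j ≤ T.card →
      T.card.factorial * (2 * Real.exp (1 / 2)) * (C * (2 * C ^ 3 * √γ)) ^ T.card
      ≤ (N.factorial * (2 * Real.exp (1 / 2)) * (2 * C ^ 4) ^ N) * √γ ^ j := by
    intro j hj
    rw [hCb, ← mul_assoc]
    gcongr ?_ * _ * ?_ * ?_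
    · exact_mod_cast Nat.factorial_le hTN
    · exact pow_le_pow_right₀ hC4 hTN
    · exact pow_le_pow_of_le_one (Real.sqrt_nonneg _) hs1 hj
  set M₀ : ℝ := N.factorial * (2 * Real.exp (1 / 2)) * (2 * C ^ 4) ^ N with hM₀
  have hM₀0 : 0 ≤ M₀ := by positivity
  have hM : momentConst N C = C ^ (2 * N + 2) * M₀ := rfl
  have hC0 : 0 < C := zero_lt_one.trans_le hC
  by_cases hTu : N - T.card = 0
  · have h4 : 4 ≤ T.card := by omega
    obtain ⟨hint, hle⟩ := integral_sum_noiseMoment_sq_le hA hσ hV hC0 hD hQ T hb hb2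
      (ω := fun _ => C ^ 2) (fun _ => by positivity) (fun y x hy hx => by
        rw [hTu, pow_zero, one_mul]; exact hy.abs_sum_mul_le_sum hx)
    refine ⟨hint, hle.trans ?_⟩
    have h5 : ∑ i, C ^ 2 * marginal D {i} ^ 2 ≤ C ^ (2 * N + 2) * (m * (q * l) ^ 2) := by
      calc ∑ i, C ^ 2 * marginal D {i} ^ 2 ≤ ∑ _i : Fin m, C ^ 2 * (q * l) ^ 2 := by
            gcongr with i
            · exact marginal_nonneg D _
            · exact hq i
        _ = C ^ 2 * (m * (q * l) ^ 2) := by simp; ring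
        _ ≤ _ := by gcongr; omega
    calc _ ≤ (C ^ (2 * N + 2) * (m * (q * l) ^ 2)) * (M₀ * √γ ^ 4) :=
          mul_le_mul h5 (hbound 4 h4) (by positivity) (by positivity)
      _ = momentConst N C * q ^ 2 * (m * l ^ 2 * γ ^ 2) := by
          rw [hM, hs4]; ring
      _ ≤ _ := by
          have := momentConst_pos N hC0
          gcongr
          exact le_add_of_nonneg_left (by positivity)
  · obtain ⟨hint, hle⟩ := integral_sum_noiseMoment_sq_le hA hσ hV hC0 hD hQ T hb hb2
      (ω := fun i => if i = i₁ then C ^ (2 * (N - T.card)) * (k * C ^ 2) else 0)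
      (fun i => by split_ifs <;> positivity)
      (fun y x hy hx => hy.abs_pow_mul_sum_le hC0.le hx hTu)
    refine ⟨hint, hle.trans ?_⟩
    have h5 : ∑ i, (if i = i₁ then C ^ (2 * (N - T.card)) * (k * C ^ 2) else 0)
        * marginal D {i} ^ 2 ≤ C ^ (2 * N + 2) * (k * q ^ 2) := by
      calc _ = C ^ (2 * (N - T.card) + 2) * (k * q ^ 2) := by
            simp only [ite_mul, zero_mul, Finset.sum_ite_eq', Finset.mem_univ, if_true]
            rw [pow_add]; ring
        _ ≤ _ := by gcongr; omega
    calc _ ≤ (C ^ (2 * N + 2) * (k * q ^ 2)) * (M₀ * √γ ^ 2) :=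
          mul_le_mul h5 (hbound 2 hT) (by positivity) (by positivity)
      _ = momentConst N C * q ^ 2 * (k * γ) := by
          rw [hM, hs2]; ring
      _ ≤ _ := by
          have := momentConst_pos N hC0
          gcongr
          exact le_add_of_nonneg_right (by positivity)

/-- Moments of the coupling weights. -/
lemma coupling_sums (hV : IsValueDistribution V C) (hC : 0 ≤ C) (hD : IsSparse D k)
    (i₁ : Fin m) (hN : 2 ≤ N) {j : ℕ} (hj : j ≠ 0) :
    ∑ i, |coupling D V i₁ N i| ^ j ≤ (C ^ (N + 1)) ^ j * (k * marginal D {i₁} ^ j) := by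
  set q := marginal D {i₁}
  have hq0 : 0 ≤ q := marginal_nonneg D _
  calc ∑ i, |coupling D V i₁ N i| ^ j
      ≤ ∑ i, (C ^ (N + 1)) ^ j * (q ^ (j - 1)
          * (sparseLaw D V).real {x | x i₁ ≠ 0 ∧ x i ≠ 0}) := by
        refine Finset.sum_le_sum fun i _ => ?_
        have h1 := abs_coupling_le hV hC hD i₁ hN i
        have h2 := measureReal_and_le (D := D) hV i₁ i
        set a := (sparseLaw D V).real {x | x i₁ ≠ 0 ∧ x i ≠ 0}
        have ha : 0 ≤ a := measureReal_nonneg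
        calc |coupling D V i₁ N i| ^ j ≤ (C ^ (N + 1) * a) ^ j := by gcongr
          _ = (C ^ (N + 1)) ^ j * (a ^ (j - 1) * a) := by
            rw [mul_pow, pow_sub_one_mul hj]
          _ ≤ _ := by gcongr
    _ = (C ^ (N + 1)) ^ j * (q ^ (j - 1)
          * ∑ i, (sparseLaw D V).real {x | x i₁ ≠ 0 ∧ x i ≠ 0}) := by
        rw [← Finset.mul_sum, ← Finset.mul_sum]
    _ ≤ (C ^ (N + 1)) ^ j * (q ^ (j - 1) * (k * q)) := by
        gcongr
        exact sum_measureReal_le hV hC hD i₁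
    _ = _ := by rw [← pow_sub_one_mul hj q]; ring

lemma integral_pi_eval {Q : Measure (Fin m → ℝ)} [IsProbabilityMeasure Q]
    {f : (Fin m → ℝ) → ℝ} (hf : Continuous f) (t : Fin N) :
    ∫ ζ, f (ζ t) ∂Measure.pi (fun _ : Fin N => Q) = ∫ x, f x ∂Q := by
  have h := integral_map (μ := Measure.pi fun _ : Fin N => Q) (φ := Function.eval t) (f := f)
    (measurable_pi_apply t).aemeasurable hf.measurable.aestronglyMeasurable
  rw [(measurePreserving_eval (fun _ : Fin N => Q) t).map_eq] at h
  exact h.symm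

/-- The constant in the bound of a single error term. -/
def errorConst (N : ℕ) (C K : ℝ) : ℝ :=
  2 * ((2 ^ N + 2 * N) * momentConst N C) + 4 * C ^ (2 * N + 4)
    + 2 * ((2 ^ N + 2 * N) * C ^ (N + 2)) ^ 2
    + 2 * (2 * (2 ^ N + 2 * N) * C ^ (4 * N + 8) * K)

/-- `hY` and `hF` are the events provided by Markov's inequality with loss J l², for the ℓ¹ norm and
for the square of the quadratic form. On them the three parts are compared with (q/e)²
deterministically. -/
lemma sum_coupling_mul_noise_sq_le {μ σ τ W b l e K J : ℝ} (hA : Incoherent A μ)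
    (hV : IsValueDistribution V C) (hC : 1 ≤ C) (hD : IsSparse D k)
    (hp : ParameterBounds n m k μ σ τ W b l e K) (hN : 2 ≤ N) (hJ : 1 ≤ J)
    {z : Fin m → ℝ} (hz : Admissible k C z)
    (hY : ∑ i, |coupling D V i₁ N i| * (if i = i₁ then 0 else |z i|)
      ≤ J * l ^ 2 * (C * (τ * (k / m)) * (C ^ (N + 1) * (k * marginal D {i₁}))))
    (hF : (∑ a, offDiag A i₁ (coupling D V i₁ N) a * (z a.1 * z a.2)) ^ 2
      ≤ J * l ^ 2 * (2 * (C ^ 4 * (τ * (k / m)) ^ 2)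
        * (σ ^ 8 * ((C ^ (N + 1)) ^ 4 * (k * marginal D {i₁} ^ 4))))) :
    σ ^ 2 * ∑ i, (coupling D V i₁ N i * noise A i₁ z i) ^ 2
      ≤ (4 * C ^ (2 * N + 4) + 2 * (J * C ^ (N + 2)) ^ 2 + 2 * (2 * J * C ^ (4 * N + 8) * K))
        * (marginal D {i₁} / e) ^ 2 := by
  set q := marginal D {i₁}
  set ρ : ℝ := τ * (k / m) with hρ
  set Y := ∑ i, |coupling D V i₁ N i| * (if i = i₁ then 0 else |z i|)
  set F := ∑ a, offDiag A i₁ (coupling D V i₁ N) a * (z a.1 * z a.2)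
  have hq0 : 0 ≤ q := marginal_nonneg D _
  have hn := hp.one_le_n
  have hk := hp.one_le_k
  have hμ := hp.one_le_mu
  have hσ1 := hp.one_le_sigma
  have hτ := hp.one_le_tau
  have hl := hp.one_le_l
  have he := hp.one_le_e
  have hK := hp.one_le_K
  have hnm := hp.n_le_m
  have hC0 : 0 < C := zero_lt_one.trans_le hC
  have hρ0 : 0 ≤ ρ := by positivity
  have hY0 : 0 ≤ Y := Finset.sum_nonneg fun i _ => by split_ifs <;> positivity
  have hs2 := coupling_sums hV hC0.le hD i₁ hN (j := 2) (by norm_num)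
  simp_rw [sq_abs] at hs2
  have hmain := hA.sum_mul_noise_sq_le (i₁ := i₁) (by exact_mod_cast hk) (coupling D V i₁ N) hz
  have t1 : σ ^ 2 * e ^ 2 * (4 * k * C ^ 2 * (μ ^ 2 / n) * ∑ i, coupling D V i₁ N i ^ 2)
      ≤ 4 * C ^ (2 * N + 4) * q ^ 2 := by
    calc _ ≤ σ ^ 2 * e ^ 2 * (4 * k * C ^ 2 * (μ ^ 2 / n)
          * ((C ^ (N + 1)) ^ 2 * (k * q ^ 2))) := by gcongr
      _ = 4 * C ^ (2 * N + 4) * q ^ 2 * (σ ^ 2 * e ^ 2 * (k ^ 2 * (μ ^ 2 / n))) := by ring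
      _ ≤ 4 * C ^ (2 * N + 4) * q ^ 2 * 1 := by gcongr; exact hp.incoherence_term_le
      _ = _ := mul_one _
  have t2 : σ * e * Y ≤ J * C ^ (N + 2) * q := by
    calc σ * e * Y ≤ σ * e * (J * l ^ 2 * (C * ρ * (C ^ (N + 1) * (k * q)))) := by gcongr
      _ = J * C ^ (N + 2) * q * (σ * e * (l ^ 2 * (ρ * k))) := by ring
      _ ≤ J * C ^ (N + 2) * q * 1 := by gcongr; exact hp.collision_term_le
      _ = _ := mul_one _
  have t3 : σ ^ 2 * e ^ 2 * F ≤ 2 * J * C ^ (4 * N + 8) * K * q ^ 2 := by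
    refine le_of_abs_le (abs_le_of_sq_le_sq ?_ (by positivity))
    calc (σ ^ 2 * e ^ 2 * F) ^ 2 = σ ^ 4 * e ^ 4 * F ^ 2 := by ring
      _ ≤ σ ^ 4 * e ^ 4 * (J * l ^ 2 * (2 * (C ^ 4 * ρ ^ 2)
          * (σ ^ 8 * ((C ^ (N + 1)) ^ 4 * (k * q ^ 4))))) := by gcongr
      _ = 2 * J * C ^ (4 * N + 8) * q ^ 4 * (σ ^ 12 * e ^ 4 * l ^ 2 * (ρ ^ 2 * k)) := by ring
      _ ≤ 2 * J * C ^ (4 * N + 8) * q ^ 4 * K := by gcongr; exact hp.offDiag_term_le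
      _ = (2 * J * C ^ (4 * N + 8) * K) * q ^ 4 := by ring
      _ ≤ (2 * J * C ^ (4 * N + 8) * K) ^ 2 * q ^ 4 := by
          gcongr
          refine le_self_pow₀ ?_ two_ne_zero
          have : 1 ≤ C ^ (4 * N + 8) := one_le_pow₀ hC
          have h1 : 1 ≤ 2 * J := by linarith
          exact one_le_mul_of_one_le_of_one_le (one_le_mul_of_one_le_of_one_le h1 this) hK
      _ = _ := by ring
  have t2' : (σ * e * Y) ^ 2 ≤ (J * C ^ (N + 2) * q) ^ 2 := by gcongr
  rw [div_pow, ← mul_div_assoc, le_div_iff₀ (by positivity)]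
  calc σ ^ 2 * (∑ i, (coupling D V i₁ N i * noise A i₁ z i) ^ 2) * e ^ 2
      = σ ^ 2 * e ^ 2 * ∑ i, (coupling D V i₁ N i * noise A i₁ z i) ^ 2 := by ring
    _ ≤ σ ^ 2 * e ^ 2 * (4 * k * C ^ 2 * (μ ^ 2 / n) * ∑ i, coupling D V i₁ N i ^ 2
          + 2 * Y ^ 2 + 2 * F) := by gcongr
    _ = σ ^ 2 * e ^ 2 * (4 * k * C ^ 2 * (μ ^ 2 / n) * ∑ i, coupling D V i₁ N i ^ 2)
          + 2 * (σ * e * Y) ^ 2 + 2 * (σ ^ 2 * e ^ 2 * F) := by ring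
    _ ≤ 4 * C ^ (2 * N + 4) * q ^ 2 + 2 * (J * C ^ (N + 2) * q) ^ 2
          + 2 * (2 * J * C ^ (4 * N + 8) * K * q ^ 2) := by gcongr
    _ = _ := by ring

/-- With high probability all error terms are small. -/
lemma le_measure_forall_noiseMoment {μ σ τ W b l e K : ℝ} (hA : Incoherent A μ)
    (hσ : dictNorm A ≤ σ) (hV : IsValueDistribution V C) (hC : 1 ≤ C) (hD : IsSparse D k)
    (hq0 : 0 < marginal D {i₁}) (hq : ∀ i, marginal D {i} ≤ marginal D {i₁} * l)
    (hp : ParameterBounds n m k μ σ τ W b l e K)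
    {Q : Measure (Fin m → ℝ)} (hQ : IsSeedLaw Q i₁ k C (τ * (k / m))) (hN : 4 ≤ N) :
    ENNReal.ofReal (1 - 1 / l ^ 2) ≤ Measure.pi (fun _ : Fin N => Q)
      {ζ | (∀ t, Admissible k C (ζ t) ∧ 0 < ζ t i₁) ∧ ∀ T : Finset (Fin N), T ≠ ∅ →
        σ ^ 2 * ∑ i, noiseMoment A (sparseLaw D V) i₁ T ζ i ^ 2
          ≤ errorConst N C K * (marginal D {i₁} / e) ^ 2} := by
  have := hQ.prob
  set q := marginal D {i₁}
  set ρ : ℝ := τ * (k / m) with hρ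
  set J : ℝ := 2 ^ N + 2 * N with hJ_def
  set θ := coupling D V i₁ N
  set γ : ℝ := k ^ 3 * τ ^ 2 * μ ^ 4 * σ ^ 8 / n ^ 2 with hγ_def
  have hn := hp.one_le_n
  have hk := hp.one_le_k
  have hμ := hp.one_le_mu
  have hσ1 := hp.one_le_sigma
  have hτ := hp.one_le_tau
  have hl := hp.one_le_l
  have he := hp.one_le_e
  have hK := hp.one_le_K
  have hnm := hp.n_le_m
  have hm0 : (0 : ℝ) < m := by linarith
  have hC0 : 0 < C := zero_lt_one.trans_le hC
  have hρ0 : 0 < ρ := by positivity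
  have hγ0 : 0 < γ := by positivity
  have hM0 := momentConst_pos N hC0
  have hJ1 : 1 ≤ J := by
    have : (1 : ℝ) ≤ 2 ^ N := one_le_pow₀ (by norm_num)
    have : (0 : ℝ) ≤ N := Nat.cast_nonneg N
    linarith
  -- One variable for each T with at least two elements and two for each seed: at most J = 2^N + 2N
  -- in all.
  set f : {T : Finset (Fin N) // 2 ≤ T.card} ⊕ Fin N ⊕ Fin N → (Fin N → Fin m → ℝ) → ℝ :=
    Sum.elim (fun T ζ => ∑ i, noiseMoment A (sparseLaw D V) i₁ T.1 ζ i ^ 2)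
      (Sum.elim (fun t ζ => ∑ i, |θ i| * (if i = i₁ then 0 else |ζ t i|))
        (fun t ζ => (∑ a, offDiag A i₁ θ a * (ζ t a.1 * ζ t a.2)) ^ 2)) with hf
  set E : {T : Finset (Fin N) // 2 ≤ T.card} ⊕ Fin N ⊕ Fin N → ℝ :=
    Sum.elim (fun _ => momentConst N C * q ^ 2 * (k * γ + m * l ^ 2 * γ ^ 2))
      (Sum.elim (fun _ => C * ρ * (C ^ (N + 1) * (k * q)))
        (fun _ => 2 * (C ^ 4 * ρ ^ 2) * (σ ^ 8 * ((C ^ (N + 1)) ^ 4 * (k * q ^ 4))))) with hE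
  have hcont : ∀ i, Continuous fun x : Fin m → ℝ => if i = i₁ then 0 else |x i| := by
    intro i; split_ifs <;> fun_prop
  have hcontY : Continuous fun x : Fin m → ℝ => ∑ i, |θ i| * (if i = i₁ then 0 else |x i|) :=
    continuous_finsetSum _ fun i _ => continuous_const.mul (hcont i)
  have hintY : ∀ i, Integrable (fun x : Fin m → ℝ => |θ i| * (if i = i₁ then 0 else |x i|)) Q :=
    fun i => hQ.integrable (continuous_const.mul (hcont i))
  have hcontF : Continuous fun x : Fin m → ℝ =>
      (∑ a, offDiag A i₁ θ a * (x a.1 * x a.2)) ^ 2 := by fun_prop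
  have hcomp : ∀ (t : Fin N) {g : (Fin m → ℝ) → ℝ}, Continuous g →
      Integrable (fun ζ : Fin N → Fin m → ℝ => g (ζ t)) (Measure.pi fun _ => Q) :=
    fun t g hg => Integrable.comp_measurable
      (by rw [(measurePreserving_eval (fun _ => Q) t).map_eq]; exact hQ.integrable hg)
      (measurable_pi_apply t)
  -- Each variable exceeds J l² times its mean bound with probability at most 1/(J l²), so the union
  -- bound gives 1/l².
  refine le_measure_of_markov (f := f) (E := E) (S := J * l ^ 2) ?_ ?_ ?_ ?_ (by positivity)
    (by positivity) ?_ ?_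
  · rintro (T | t | t)
    · exact (integral_sum_noiseMoment_sq_le_momentConst hA hσ hV hC hD hq hp hQ hN T.1 T.2).1
    · exact hcomp t hcontY
    · exact hcomp t hcontF
  · rintro (T | t | t) ζ
    · exact Finset.sum_nonneg fun _ _ => sq_nonneg _
    · change 0 ≤ ∑ i, |θ i| * (if i = i₁ then 0 else |ζ t i|)
      exact Finset.sum_nonneg fun i _ => by split_ifs <;> positivity
    · exact sq_nonneg _
  · rintro (T | t | t) <;> simp only [hE, Sum.elim_inl, Sum.elim_inr] <;> positivity
  · rintro (T | t | t)
    · exact (integral_sum_noiseMoment_sq_le_momentConst hA hσ hV hC hD hq hp hQ hN T.1 T.2).2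
    · simp only [hf, hE, Sum.elim_inl, Sum.elim_inr]
      rw [integral_pi_eval hcontY t,
        integral_finsetSum _ fun i _ => hintY i]
      have hs1 := coupling_sums hV hC0.le hD i₁ (show 2 ≤ N by omega) (j := 1) (by norm_num)
      simp only [pow_one] at hs1
      calc ∑ i, ∫ x, |θ i| * (if i = i₁ then 0 else |x i|) ∂Q ≤ ∑ i, |θ i| * (C * ρ) := by
            refine Finset.sum_le_sum fun i _ => ?_
            rw [integral_const_mul]
            gcongr
            split_ifs with hi
            · simp; positivity
            · exact hQ.integral_abs_le_of_ne hC0.le hi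
        _ = C * ρ * ∑ i, |θ i| := by rw [← Finset.sum_mul, mul_comm]
        _ ≤ _ := by gcongr
    · simp only [hf, hE, Sum.elim_inr]
      rw [integral_pi_eval hcontF t]
      have hs4 := coupling_sums hV hC0.le hD i₁ (show 2 ≤ N by omega) (j := 4) (by norm_num)
      have habs : ∀ i, |coupling D V i₁ N i| ^ 4 = coupling D V i₁ N i ^ 4 := fun i =>
        (show Even 4 by decide).pow_abs _
      simp_rw [habs] at hs4
      refine (hQ.integral_offDiag_sq_le (offDiag_swap A i₁ θ) fun a ha => ?_).trans ?_
      · by_contra h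
        exact ha (by rw [offDiag, if_neg h])
      · gcongr
        exact (sum_offDiag_sq_le hσ i₁ θ).trans (by gcongr)
  · have h1 : Fintype.card {T : Finset (Fin N) // 2 ≤ T.card} ≤ 2 ^ N := by
      refine (Fintype.card_subtype_le _).trans ?_
      simp
    have h2 : (Fintype.card {T : Finset (Fin N) // 2 ≤ T.card} : ℝ) ≤ 2 ^ N := by
      exact_mod_cast h1
    rw [Fintype.card_sum, Fintype.card_sum, Fintype.card_fin]
    push_cast
    have h3 : 1 / l ^ 2 * (J * l ^ 2) = J := by field_simp
    rw [h3]
    linarith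
  · filter_upwards [ae_pi_forall (N := N) hQ.admissible, ae_pi_forall (N := N) hQ.pos]
      with ζ hadm hpos hgood
    refine ⟨fun t => ⟨hadm t, hpos t⟩, fun T hT => ?_⟩
    have hsplit : errorConst N C K = 2 * (J * momentConst N C)
      + (4 * C ^ (2 * N + 4) + 2 * (J * C ^ (N + 2)) ^ 2
        + 2 * (2 * J * C ^ (4 * N + 8) * K)) := by
      rw [errorConst]; ring
    rw [hsplit, add_mul]
    by_cases hT2 : 2 ≤ T.card
    · have h := hgood (Sum.inl ⟨T, hT2⟩)
      simp only [hf, hE, Sum.elim_inl] at h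
      refine le_trans ?_ (le_add_of_nonneg_right (by positivity))
      rw [div_pow, ← mul_div_assoc, le_div_iff₀ (by positivity)]
      calc σ ^ 2 * (∑ i, noiseMoment A (sparseLaw D V) i₁ T ζ i ^ 2) * e ^ 2
          = σ ^ 2 * e ^ 2 * ∑ i, noiseMoment A (sparseLaw D V) i₁ T ζ i ^ 2 := by ring
        _ ≤ σ ^ 2 * e ^ 2 * (J * l ^ 2 * (momentConst N C * q ^ 2
              * (k * γ + m * l ^ 2 * γ ^ 2))) := by gcongr
        _ = J * momentConst N C * q ^ 2 * (σ ^ 2 * e ^ 2 * l ^ 2 * (k * γ)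
              + σ ^ 2 * e ^ 2 * l ^ 2 * (m * l ^ 2 * γ ^ 2)) := by ring
        _ ≤ J * momentConst N C * q ^ 2 * (1 + 1) := by
            gcongr
            · exact hp.pair_term_le
            · exact hp.full_term_le
        _ = _ := by ring
    · have h1 : T.card = 1 := by
        have := Finset.card_pos.2 (Finset.nonempty_iff_ne_empty.2 hT)
        omega
      obtain ⟨t, rfl⟩ := Finset.card_eq_one.1 h1
      simp_rw [noiseMoment_singleton A hV hC0.le hD]
      refine le_trans ?_ (le_add_of_nonneg_left (by positivity))
      exact sum_coupling_mul_noise_sq_le hA hV hC hD hp (by omega) hJ1 (hadm t)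
        (hgood (Sum.inr (Sum.inl t))) (hgood (Sum.inr (Sum.inr t)))

end Assembly

/-! ### The main term and the assembly of the theorem -/

section Final

variable {n m k N : ℕ} {A : Matrix (Fin n) (Fin m) ℝ} {V : Measure ℝ} {C : ℝ}
  {D : PMF (Finset (Fin m))} {i₁ : Fin m}

lemma moment_mem_Icc (hV : IsValueDistribution V C) (hC : 0 ≤ C) (hD : IsSparse D k)
    (i : Fin m) {d : ℕ} (hd : Even d) (hd0 : d ≠ 0) :
    marginal D {i} ≤ moment D V i d ∧ moment D V i d ≤ C ^ d * marginal D {i} := by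
  have := hV.isProbabilityMeasure
  have hs : MeasurableSet {x : Fin m → ℝ | x i ≠ 0} := by
    simpa using measurableSet_forall_ne_zero {i}
  have hint : Integrable (fun x : Fin m → ℝ => x i ^ d) (sparseLaw D V) :=
    integrable_sparseLaw hV hC hD (by fun_prop)
  rw [← measureReal_ne_zero hV D i]
  constructor
  · calc (sparseLaw D V).real {x | x i ≠ 0}
        = ∫ x, {x : Fin m → ℝ | x i ≠ 0}.indicator (fun _ => (1 : ℝ)) x ∂sparseLaw D V := by
          rw [integral_indicator hs, setIntegral_const]; simp
      _ ≤ ∫ x, x i ^ d ∂sparseLaw D V := by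
          refine integral_mono_ae ((integrable_const _).indicator hs) hint ?_
          filter_upwards [ae_admissible hV hC hD] with x hx
          by_cases h : x i = 0
          · simp [h, hd0]
          · rw [Set.indicator_of_mem (show x ∈ {x : Fin m → ℝ | x i ≠ 0} from h), ← hd.pow_abs]
            exact one_le_pow₀ (hx.one_le i h)
  · refine integral_le_of_ae_le_indicator hint hs ?_
    filter_upwards [ae_admissible hV hC hD] with x hx
    by_cases h : x i = 0
    · simp [h, hd0]
    · rw [Set.indicator_of_mem (show x ∈ {x : Fin m → ℝ | x i ≠ 0} from h), ← hd.pow_abs]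
      have := hx.abs_le i
      gcongr

lemma Admissible.mem_Icc_of_pos {x : Fin m → ℝ} (hx : Admissible k C x) (h : 0 < x i₁) :
    1 ≤ x i₁ ∧ x i₁ ≤ C := by
  have h1 := hx.one_le i₁ h.ne'
  have h2 := hx.abs_le i₁
  rw [abs_of_pos h] at h1 h2
  exact ⟨h1, h2⟩

/-- The bounds for the coefficient of the main term. -/
lemma main_coeff_mem_Icc (hV : IsValueDistribution V C) (hC : 1 ≤ C) (hD : IsSparse D k)
    (hN : Odd N) {ζ : Fin N → Fin m → ℝ} (hζ : ∀ t, Admissible k C (ζ t) ∧ 0 < ζ t i₁) :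
    marginal D {i₁} ≤ moment D V i₁ (N + 1) * ∏ t, ζ t i₁ ∧
    moment D V i₁ (N + 1) * ∏ t, ζ t i₁ ≤ C ^ (2 * N + 1) * marginal D {i₁} := by
  have hC0 : 0 ≤ C := zero_le_one.trans hC
  obtain ⟨h1, h2⟩ := moment_mem_Icc hV hC0 hD i₁ (d := N + 1) hN.add_one (by omega)
  have hq := marginal_nonneg D {i₁}
  have hIcc := fun t => (hζ t).1.mem_Icc_of_pos (hζ t).2
  have h3 : 1 ≤ ∏ t, ζ t i₁ := by
    simpa using Finset.prod_le_prod (s := Finset.univ) (f := fun _ : Fin N => (1 : ℝ))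
      (fun _ _ => zero_le_one) fun t _ => (hIcc t).1
  have h4 : ∏ t, ζ t i₁ ≤ C ^ N := by
    calc ∏ t, ζ t i₁ ≤ ∏ _t : Fin N, C :=
          Finset.prod_le_prod (fun t _ => (hζ t).2.le) fun t _ => (hIcc t).2
      _ = C ^ N := by simp
  constructor
  · exact h1.trans (le_mul_of_one_le_right (hq.trans h1) h3)
  · calc moment D V i₁ (N + 1) * ∏ t, ζ t i₁ ≤ (C ^ (N + 1) * marginal D {i₁}) * C ^ N := by
          gcongr
      _ = _ := by ring

/-- Removing T = ∅ removes the main term exactly. Each of the fewer than 2^N other terms has a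
prefactor at most C^N, and A expands its coefficient vector by at most σ. -/
lemma norm_statistic_sub_le {σ X : ℝ} (hσ : dictNorm A ≤ σ) (hV : IsValueDistribution V C)
    (hC : 1 ≤ C) (hD : IsSparse D k) {ζ : Fin N → Fin m → ℝ}
    (hζ : ∀ t, Admissible k C (ζ t) ∧ 0 < ζ t i₁) (hX : 0 ≤ X)
    (h : ∀ T : Finset (Fin N), T ≠ ∅ →
      σ ^ 2 * ∑ i, noiseMoment A (sparseLaw D V) i₁ T ζ i ^ 2 ≤ X ^ 2) :
    ‖statistic A D V ζ - (moment D V i₁ (N + 1) * ∏ t, ζ t i₁) • column A i₁‖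
      ≤ 2 ^ N * (C ^ N * X) := by
  have hC0 : 0 ≤ C := zero_le_one.trans hC
  have hmain : (∏ t ∈ (∅ : Finset (Fin N))ᶜ, ζ t i₁) •
      synth A (noiseMoment A (sparseLaw D V) i₁ ∅ ζ)
      = (moment D V i₁ (N + 1) * ∏ t, ζ t i₁) • column A i₁ := by
    rw [synth_noiseMoment_empty A hV, smul_smul, Finset.compl_empty, mul_comm]
  rw [statistic_eq_sum A hV hC0 hD i₁, ← hmain,
    ← Finset.add_sum_erase _ _ (Finset.mem_univ (∅ : Finset (Fin N))), add_sub_cancel_left]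
  calc _ ≤ ∑ T ∈ Finset.univ.erase (∅ : Finset (Fin N)), C ^ N * X := by
        refine (norm_sum_le _ _).trans (Finset.sum_le_sum fun T hT => ?_)
        rw [norm_smul]
        have h1 : ‖∏ t ∈ Tᶜ, ζ t i₁‖ ≤ C ^ N := by
          rw [norm_prod]
          calc ∏ t ∈ Tᶜ, ‖ζ t i₁‖ ≤ ∏ _t ∈ Tᶜ, C :=
                Finset.prod_le_prod (fun _ _ => norm_nonneg _) fun t _ => (hζ t).1.abs_le i₁
            _ = C ^ Tᶜ.card := Finset.prod_const _
            _ ≤ C ^ N := pow_le_pow_right₀ hC (by simpa using Finset.card_le_univ Tᶜ)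
        have h2 : ‖synth A (noiseMoment A (sparseLaw D V) i₁ T ζ)‖ ≤ X :=
          (sq_le_sq₀ (norm_nonneg _) hX).1
            ((norm_synth_sq_le hσ _).trans (h T (Finset.ne_of_mem_erase hT)))
        gcongr
    _ ≤ ∑ _T : Finset (Fin N), C ^ N * X :=
        Finset.sum_le_sum_of_subset_of_nonneg (Finset.erase_subset _ _)
          fun _ _ _ => by positivity
    _ = _ := by simp

lemma Incoherent.norm_synth_le {μ : ℝ} (hA : Incoherent A μ) (x : Fin m → ℝ) :
    ‖synth A x‖ ≤ ∑ i, |x i| := by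
  rw [synth_eq_sum]
  refine (norm_sum_le _ _).trans (le_of_eq ?_)
  simp [norm_smul, hA.norm_column]

/-- The trivial bound of the statistic. -/
lemma Incoherent.norm_statistic_le {μ : ℝ} (hA : Incoherent A μ) (hV : IsValueDistribution V C)
    (hC : 0 ≤ C) (hD : IsSparse D k) {ζ : Fin N → Fin m → ℝ}
    (hζ : ∀ t, Admissible k C (ζ t)) :
    ‖statistic A D V ζ‖ ≤ ((m * C) * (m * C)) ^ N * ∑ i, C * marginal D {i} := by
  have := hV.isProbabilityMeasure
  have hs : ∀ i, MeasurableSet {x : Fin m → ℝ | x i ≠ 0} := fun i => by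
    simpa using measurableSet_forall_ne_zero {i}
  have hnorm : ∀ x : Fin m → ℝ, Admissible k C x → ‖synth A x‖ ≤ m * C := by
    intro x hx
    refine (hA.norm_synth_le x).trans ((Finset.sum_le_sum fun i _ => hx.abs_le i).trans ?_)
    simp
  have hint : ∀ i, Integrable (fun x : Fin m → ℝ => |x i|) (sparseLaw D V) := fun i =>
    integrable_sparseLaw hV hC hD (by fun_prop)
  calc ‖statistic A D V ζ‖
      ≤ ∫ x, ((m * C) * (m * C)) ^ N * ∑ i, |x i| ∂sparseLaw D V := by
        refine norm_integral_le_of_norm_le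
          ((integrable_finsetSum _ fun i _ => hint i).const_mul _) ?_
        filter_upwards [ae_admissible hV hC hD] with x hx
        rw [norm_smul, norm_prod]
        gcongr
        · calc ∏ t, ‖inner ℝ (synth A (ζ t)) (synth A x)‖ ≤ ∏ _t : Fin N, (m * C) * (m * C) := by
                refine Finset.prod_le_prod (fun _ _ => norm_nonneg _) fun t _ => ?_
                refine (norm_inner_le_norm _ _).trans ?_
                exact mul_le_mul (hnorm _ (hζ t)) (hnorm _ hx) (norm_nonneg _) (by positivity)
            _ = _ := by simp
        · exact hA.norm_synth_le x
    _ = ((m * C) * (m * C)) ^ N * ∑ i, ∫ x, |x i| ∂sparseLaw D V := by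
        rw [integral_const_mul, integral_finsetSum _ fun i _ => hint i]
    _ ≤ _ := by
        gcongr with i
        rw [← measureReal_ne_zero hV D i]
        refine integral_le_of_ae_le_indicator (hint i) (hs i) ?_
        filter_upwards [ae_admissible hV hC hD] with x hx
        by_cases h : x i = 0
        · simp [h]
        · rw [Set.indicator_of_mem (show x ∈ {x : Fin m → ℝ | x i ≠ 0} from h)]
          exact hx.abs_le i

/-- The trivial bound of the error, relative to the marginal of `i₁`. -/
lemma Incoherent.norm_statistic_sub_le_of_marginal_le {μ l M : ℝ} (hA : Incoherent A μ)
    (hV : IsValueDistribution V C) (hC : 1 ≤ C) (hD : IsSparse D k) (hN : Odd N)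
    {ζ : Fin N → Fin m → ℝ} (hζ : ∀ t, Admissible k C (ζ t) ∧ 0 < ζ t i₁)
    (hq : ∀ i, marginal D {i} ≤ marginal D {i₁} * l) (hl : 0 ≤ l) (hlM : l ≤ M) (hmM : m ≤ M) :
    ‖statistic A D V ζ - (moment D V i₁ (N + 1) * ∏ t, ζ t i₁) • column A i₁‖
      ≤ (((M * C) * (M * C)) ^ N * (M * (C * M)) + C ^ (2 * N + 1)) * marginal D {i₁} := by
  have hC0 : 0 ≤ C := zero_le_one.trans hC
  have hM : 0 ≤ M := hl.trans hlM
  have hq0 := marginal_nonneg D {i₁}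
  obtain ⟨h1, h2⟩ := main_coeff_mem_Icc hV hC hD hN hζ
  have h3 := hA.norm_statistic_le hV hC0 hD fun t => (hζ t).1
  have h4 : ∑ i, C * marginal D {i} ≤ M * (C * (marginal D {i₁} * M)) := by
    calc ∑ i, C * marginal D {i} ≤ ∑ _i : Fin m, C * (marginal D {i₁} * M) := by
          gcongr with i
          exact (hq i).trans (by gcongr)
      _ = m * (C * (marginal D {i₁} * M)) := by simp
      _ ≤ _ := by gcongr
  calc _ ≤ ‖statistic A D V ζ‖ + ‖(moment D V i₁ (N + 1) * ∏ t, ζ t i₁) • column A i₁‖ :=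
        norm_sub_le _ _
    _ ≤ ((M * C) * (M * C)) ^ N * (M * (C * (marginal D {i₁} * M)))
        + C ^ (2 * N + 1) * marginal D {i₁} := by
        gcongr
        · refine h3.trans (mul_le_mul ?_ h4 ?_ (by positivity))
          · gcongr
          · exact Finset.sum_nonneg fun i _ => mul_nonneg hC0 (marginal_nonneg D _)
        · rw [norm_smul, hA.norm_column, mul_one, Real.norm_of_nonneg (hq0.trans h1)]
          exact h2
    _ = _ := by ring

end Final

end SparseCoding

end

/-! ### Choice of the constants and degenerate cases -/

theorem theorem5p9 :
    ∃ c₁ : ℝ, 0 < c₁ ∧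
    ∀ (c : ℝ) (L : ℕ) (C κ : ℝ), 2 ≤ c → 8 ≤ L → 1 ≤ C → 0 < κ →
    ∃ K : ℝ, 0 < K ∧
    ∀ (n m k : ℕ) (A : Matrix (Fin n) (Fin m) ℝ) (μ σ τ : ℝ) (V : Measure ℝ)
      (R D : PMF (Finset (Fin m))) (i₁ : Fin m),
      n ≤ m → 2 ≤ m → 1 ≤ k → 1 ≤ μ → 1 ≤ τ →
      SparseCoding.Incoherent A μ →
      SparseCoding.dictNorm A ≤ σ →
      SparseCoding.IsValueDistribution V C →
      SparseCoding.IsRandomSupport R k τ κ →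
      SparseCoding.IsSparse D k →
      (∀ i, SparseCoding.marginal D {i} / Real.log m ≤ SparseCoding.marginal D {i₁}) →
      (k : ℝ) ≤ √(n : ℝ) /
        (SparseCoding.nu c₁ C σ μ n m (1 / (m : ℝ)) (2 * L) * τ * μ ^ 2 *
          Real.log m ^ max 0 (c - 4 * L)) →
      ENNReal.ofReal (1 - 1 / Real.log m ^ 2) ≤
        SparseCoding.tupleLaw R V i₁ (2 * L - 1)
          {ζ | ∃ (a : ℝ) (e : EuclideanSpace ℝ (Fin n)),
            SparseCoding.statistic A D V ζ = a • SparseCoding.column A i₁ + e ∧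
            a = SparseCoding.moment D V i₁ (2 * L) * ∏ t, ζ t i₁ ∧
            SparseCoding.marginal D {i₁} ≤ a ∧
            a ≤ C ^ (4 * L - 1) * SparseCoding.marginal D {i₁} ∧
            ‖e‖ ≤ K * (SparseCoding.marginal D {i₁} / Real.log m ^ c)} := by
  refine ⟨1, one_pos, fun c L C κ hc hL hC hκ => ?_⟩
  set N := 2 * L - 1 with hN_def
  have hNodd : Odd N := ⟨L - 1, by omega⟩
  have hN1 : N + 1 = 2 * L := by omega
  have hN2 : 2 * N + 1 = 4 * L - 1 := by omega
  set K₀ : ℝ := (4 * (c + 2)) ^ (c + 2)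
  set M : ℝ := Real.exp (2 / κ)
  set X : ℝ := ((M * C) * (M * C)) ^ N * (M * (C * M)) + C ^ (2 * N + 1)
  set Y : ℝ := 2 ^ N * (C ^ N * √(SparseCoding.errorConst N C K₀))
  have hC0 : 0 < C := zero_lt_one.trans_le hC
  have hM1 : 1 ≤ M := Real.one_le_exp (by positivity)
  have hX : 0 < X := by positivity
  have hY : 0 ≤ Y := by positivity
  -- Y serves the main case κ log m ≥ 2. Otherwise m < M = exp (2/κ), and X M^c covers the trivial
  -- bound.
  refine ⟨X * M ^ c + Y, by positivity, ?_⟩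
  intro n m k A μ σ τ V R D i₁ hnm hm hk hμ hτ hA hσ hV hR hD hq hkn
  have hm1 : (1 : ℝ) < m := by exact_mod_cast hm
  have hl0 : 0 < Real.log m := Real.log_pos hm1
  set l := Real.log m with hl_def
  set q := SparseCoding.marginal D {i₁} with hq_def
  have hq0 : 0 ≤ q := SparseCoding.marginal_nonneg D _
  replace hq : ∀ i, SparseCoding.marginal D {i} ≤ q * l := fun i => (div_le_iff₀ hl0).1 (hq i)
  set G : Set (Fin N → Fin m → ℝ) := {ζ | ∃ (a : ℝ) (e : EuclideanSpace ℝ (Fin n)),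
    SparseCoding.statistic A D V ζ = a • SparseCoding.column A i₁ + e ∧
    a = SparseCoding.moment D V i₁ (2 * L) * ∏ t, ζ t i₁ ∧
    q ≤ a ∧ a ≤ C ^ (4 * L - 1) * q ∧ ‖e‖ ≤ (X * M ^ c + Y) * (q / l ^ c)}
  have hmem : ∀ ζ : Fin N → Fin m → ℝ,
      (∀ t, SparseCoding.Admissible k C (ζ t) ∧ 0 < ζ t i₁) →
      ‖SparseCoding.statistic A D V ζ
        - (SparseCoding.moment D V i₁ (N + 1) * ∏ t, ζ t i₁) • SparseCoding.column A i₁‖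
        ≤ (X * M ^ c + Y) * (q / l ^ c) → ζ ∈ G := by
    intro ζ hζ he
    obtain ⟨h1, h2⟩ := SparseCoding.main_coeff_mem_Icc hV hC hD hNodd hζ
    rw [hN1] at he h1 h2
    rw [hN2] at h2
    exact ⟨_, _, (add_sub_cancel _ _).symm, rfl, h1, h2, he⟩
  obtain ⟨hprob, hae⟩ := hR.cond_pos hV hC0.le i₁ hk
  have hsure : (∀ ζ : Fin N → Fin m → ℝ,
      (∀ t, SparseCoding.Admissible k C (ζ t) ∧ 0 < ζ t i₁) →
      ‖SparseCoding.statistic A D V ζ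
        - (SparseCoding.moment D V i₁ (N + 1) * ∏ t, ζ t i₁) • SparseCoding.column A i₁‖
        ≤ (X * M ^ c + Y) * (q / l ^ c)) →
      ENNReal.ofReal (1 - 1 / l ^ 2) ≤ SparseCoding.tupleLaw R V i₁ N G := by
    intro h
    have h1 : ∀ᵐ ζ ∂SparseCoding.tupleLaw R V i₁ N, ζ ∈ G := by
      filter_upwards [SparseCoding.ae_pi_forall (N := N) hae] with ζ hζ
      exact hmem ζ hζ (h ζ hζ)
    have h2 : SparseCoding.tupleLaw R V i₁ N Set.univ = 1 := by
      unfold SparseCoding.tupleLaw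
      exact measure_univ
    have hG : SparseCoding.tupleLaw R V i₁ N G = 1 :=
      (measure_congr (Filter.eventuallyEq_univ.2 h1)).trans h2
    rw [hG]
    have h3 : 0 ≤ 1 / l ^ 2 := by positivity
    exact ENNReal.ofReal_le_one.2 (by linarith)
  -- For l < 1 the claimed probability is not positive.
  by_cases hl1 : l < 1
  · have h1 : 1 - 1 / l ^ 2 ≤ 0 := by
      rw [sub_nonpos, le_div_iff₀ (by positivity), one_mul]
      exact pow_le_one₀ hl0.le hl1.le
    rw [ENNReal.ofReal_of_nonpos h1]
    exact zero_le
  rw [not_lt] at hl1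
  -- Markov's inequality needs positive bounds for the means, hence q > 0. If q = 0, all marginals
  -- vanish by `hq`, and so does the error for admissible seeds.
  rcases hq0.eq_or_lt with hq00 | hqpos
  · refine hsure fun ζ hζ => ?_
    have h := hA.norm_statistic_sub_le_of_marginal_le hV hC hD hNodd hζ hq hl0.le
      (le_max_left l m) (le_max_right l m)
    rw [← hq_def, ← hq00, mul_zero] at h
    rw [← hq00, zero_div, mul_zero]
    exact h
  by_cases hκl : 2 ≤ κ * l
  · have hσ1 := hA.one_le_sigma hσ i₁
    have hn : 1 ≤ n := by
      by_contra h0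
      have h00 : n = 0 := by omega
      subst h00
      have := hA.norm_column i₁
      rw [Subsingleton.elim (SparseCoding.column A i₁) 0, norm_zero] at this
      exact zero_ne_one this
    obtain ⟨W, b, hp⟩ := SparseCoding.parameterBounds hc hL hC hn hnm hk hμ hσ1 hτ hl1 hkn
    have hQ := hR.isSeedLaw hV hC0.le i₁ hk (zero_le_one.trans hτ) hκl
    refine (SparseCoding.le_measure_forall_noiseMoment hA hσ hV hC hD hqpos hq hp hQ
      (N := N) (by omega)).trans (measure_mono ?_)
    rintro ζ ⟨hζ, hgood⟩
    refine hmem ζ hζ ?_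
    have hE : 0 ≤ SparseCoding.errorConst N C K₀ := by
      have := SparseCoding.momentConst_pos N hC0
      have : 0 ≤ K₀ := Real.rpow_nonneg (by linarith) _
      unfold SparseCoding.errorConst
      positivity
    have h := SparseCoding.norm_statistic_sub_le hσ hV hC hD hζ
      (X := √(SparseCoding.errorConst N C K₀) * (q / l ^ c)) (by positivity) fun T hT => by
        rw [mul_pow, Real.sq_sqrt hE]
        exact hgood T hT
    refine h.trans ?_
    calc _ = Y * (q / l ^ c) := by ring
      _ ≤ _ := by
        gcongr
        exact le_add_of_nonneg_left (by positivity)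
  · rw [not_le] at hκl
    have hlM : l ≤ 2 / κ := by rw [le_div_iff₀ hκ]; linarith
    have hmM : (m : ℝ) ≤ M := by
      rw [← Real.exp_log (zero_lt_one.trans hm1)]
      exact Real.exp_le_exp.2 hlM
    have hlm : l ≤ M := (Real.log_le_self (Nat.cast_nonneg m)).trans hmM
    refine hsure fun ζ hζ => ?_
    refine (hA.norm_statistic_sub_le_of_marginal_le hV hC hD hNodd hζ hq hl0.le hlm hmM).trans ?_
    rw [← mul_div_assoc, le_div_iff₀ (by positivity)]
    calc X * q * l ^ c ≤ X * q * M ^ c := by gcongr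
      _ = X * M ^ c * q := by ring
      _ ≤ _ := by gcongr; exact le_add_of_nonneg_right hY
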